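/- Let $E$ take values in a finite interval $(e_{\min},e_{\max})$, $e_{\min}<e_{\max}$, and $Q$ in a finite interval $(q_{\min},q_{\max})$. A channel is given by (jointly measurable) conditional densities $f(q|e)=f_{Q|E}(q|e)$ of $Q$ given $E=e$, with convergent entropy integrals $h(Q|e)=-\int f(q|e)\log_2 f(q|e)\,dq$. Write $m(e)$ and $\sigma(e)$ for the mean and the standard deviation of $f(\cdot|e)$, $\sigma_{\max}=\sup_e\sigma(e)$, and $\phi(x|e)=\sigma(e)f(m(e)+\sigma(e)x\,|\,e)$ for the standardised density. For a density $p$ of $E$ on $(e_{\min},e_{\max})$ let $f_Q(q)=\int f(q|e)p(e)\,de$ and $I_p(Q;E)=-\int f_Q\log_2 f_Q\,dq-\int h(Q|e)p(e)\,de$; the channel capacity $\widetilde I(Q;E)$ is the supremum of $I_p(Q;E)$ over all such $p$. Let $N=\int_{e_{\min}}^{e_{\max}}\frac{m'(x)}{2^{h(Q|x)}}\,dx$. Consider a family of channels $f_i$ with these common ranges, indexed by a set with a filter along which limits are taken (for example a sequence), in the slow-change regime, that is: (i) $m_i$, $m_i'$, $\sigma_i$ are differentiable on $(e_{\min},e_{\max})$,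 and $\phi_i(x|e)$ is differentiable in $e$ wherever $q_{\min}<m_i(e)+\sigma_i(e)x<q_{\max}$; (ii) $m_i'(e)\ge c$ for all $i$ and $e$, with a constant $c>0$; (iii) $\sigma_{\max,i}\to0$; (iv) there are $\delta_i\to0$ such that, for all $i$, $e$ and all $x$ as in (i), $\sigma_{\max,i}|m_i''(e)|\le\delta_i m_i'(e)$, $\sigma_{\max,i}|\sigma_i'(e)|\le\delta_i\sigma_i(e)$ and $\sigma_{\max,i}|\partial_e\phi_i(x|e)|\le\delta_i\phi_i(x|e)$; (v) for every $\eta>0$ there is $B\ge1$ such that $\int_{\{x:\,\phi_i(x|e)>B\}}\phi_i(x|e)\log_2\phi_i(x|e)\,dx\le\eta$ for all $i$ and $e$. Then for every $i$ the capacity $\widetilde I_i(Q;E)$ is finite and $N_i>0$ (and finite), and the capacity is asymptotically $\log_2 N_i$: $$\widetilde I_i(Q;E)-\log_2\left(\int_{e_{\min}}^{e_{\max}}\frac{m_i'(x)}{2^{h_i(Q|x)}}\,dx\right)\longrightarrow 0 .$$ -/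

import Mathlib

open MeasureTheory Set Filter Topology

namespace SlowChange

/-- Differential entropy, in bits, of a probability density on the line. -/
noncomputable def entropy (p : ℝ → ℝ) : ℝ :=
  -∫ x, p x * Real.logb 2 (p x)

/-- `f e q` is the conditional density of the output `Q` at `q`, given that the input `E` is `e`,
where `E` takes values in `(eMin, eMax)` and `Q` takes values in `(qMin, qMax)`. The last field
says that the entropy integral of each conditional density converges. -/
structure IsChannel (eMin eMax qMin qMax : ℝ) (f : ℝ → ℝ → ℝ) : Prop where
  measurable : Measurable (fun z : ℝ × ℝ => f z.1 z.2)
  nonneg : ∀ e ∈ Ioo eMin eMax, ∀ q, 0 ≤ f e q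
  eq_zero : ∀ e ∈ Ioo eMin eMax, ∀ q ∉ Ioo qMin qMax, f e q = 0
  integral_eq_one : ∀ e ∈ Ioo eMin eMax, ∫ q, f e q = 1
  integrable_entropy : ∀ e ∈ Ioo eMin eMax, Integrable (fun q => f e q * Real.logb 2 (f e q))

/-- `p` is a probability density on `(eMin, eMax)`. -/
structure IsInputDensity (eMin eMax : ℝ) (p : ℝ → ℝ) : Prop where
  measurable : Measurable p
  nonneg : ∀ e, 0 ≤ p e
  eq_zero : ∀ e ∉ Ioo eMin eMax, p e = 0
  integral_eq_one : ∫ e, p e = 1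

/-- The density of `Q` when `E` has density `p`. -/
noncomputable def outputDensity (f : ℝ → ℝ → ℝ) (p : ℝ → ℝ) (q : ℝ) : ℝ :=
  ∫ e, f e q * p e

/-- The mutual information `I(Q;E) = h(Q) - ∫ h(Q|e) p(e) de` when `E` has density `p`. -/
noncomputable def mutualInfo (f : ℝ → ℝ → ℝ) (p : ℝ → ℝ) : ℝ :=
  entropy (outputDensity f p) - ∫ e, entropy (f e) * p e

/-- All values of the mutual information, over the densities of `E` on `(eMin, eMax)`. -/
def mutualInfoValues (eMin eMax : ℝ) (f : ℝ → ℝ → ℝ) : Set ℝ :=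
  {I | ∃ p, IsInputDensity eMin eMax p ∧ I = mutualInfo f p}

/-- The channel capacity: the largest mutual information (as a supremum, which need not be
attained by a density). -/
noncomputable def capacity (eMin eMax : ℝ) (f : ℝ → ℝ → ℝ) : ℝ :=
  sSup (mutualInfoValues eMin eMax f)

/-- The conditional mean `m(e)` of `Q` given `E = e`. -/
noncomputable def mean (f : ℝ → ℝ → ℝ) (e : ℝ) : ℝ :=
  ∫ q, q * f e q

/-- The conditional standard deviation `σ(e)` of `Q` given `E = e`. -/
noncomputable def stdDev (f : ℝ → ℝ → ℝ) (e : ℝ) : ℝ :=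
  Real.sqrt (∫ q, (q - mean f e) ^ 2 * f e q)

/-- `σ_max`, the largest conditional standard deviation. -/
noncomputable def sigmaMax (eMin eMax : ℝ) (f : ℝ → ℝ → ℝ) : ℝ :=
  sSup (stdDev f '' Ioo eMin eMax)

/-- The standardised conditional density `φ(x|e)`, for which
`f e q = φ((q - m(e)) / σ(e) | e) / σ(e)`. -/
noncomputable def shape (f : ℝ → ℝ → ℝ) (e x : ℝ) : ℝ :=
  stdDev f e * f e (mean f e + stdDev f e * x)

/-- The normalising constant `N = ∫ m'(x) / 2 ^ h(Q|x) dx`. -/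
noncomputable def normConst (eMin eMax : ℝ) (f : ℝ → ℝ → ℝ) : ℝ :=
  ∫ x in eMin..eMax, deriv (mean f) x / (2 : ℝ) ^ entropy (f x)

/-- `m'`, `σ` and `φ(x|·)` change by a fraction of at most about `δ` when `e` changes by `σ_max`:
the logarithmic derivatives in `e` of these functions, times `σ_max`, are at most `δ` in absolute
value (written without division, so that zeros of `φ` are allowed). The condition on `φ` is
imposed for `x` in the range that corresponds to `q` in `(qMin, qMax)`. -/
structure HasSlowChange (eMin eMax qMin qMax δ : ℝ) (f : ℝ → ℝ → ℝ) : Prop where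
  mean_differentiable : ∀ e ∈ Ioo eMin eMax, DifferentiableAt ℝ (mean f) e
  deriv_mean_differentiable : ∀ e ∈ Ioo eMin eMax, DifferentiableAt ℝ (deriv (mean f)) e
  deriv_mean_slow : ∀ e ∈ Ioo eMin eMax,
    sigmaMax eMin eMax f * |deriv (deriv (mean f)) e| ≤ δ * deriv (mean f) e
  stdDev_differentiable : ∀ e ∈ Ioo eMin eMax, DifferentiableAt ℝ (stdDev f) e
  stdDev_slow : ∀ e ∈ Ioo eMin eMax,
    sigmaMax eMin eMax f * |deriv (stdDev f) e| ≤ δ * stdDev f e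
  shape_differentiable : ∀ e ∈ Ioo eMin eMax, ∀ x,
    mean f e + stdDev f e * x ∈ Ioo qMin qMax → DifferentiableAt ℝ (fun r => shape f r x) e
  shape_slow : ∀ e ∈ Ioo eMin eMax, ∀ x, mean f e + stdDev f e * x ∈ Ioo qMin qMax →
    sigmaMax eMin eMax f * |deriv (fun r => shape f r x) e| ≤ δ * shape f e x

/-- A family of channels, with common finite ranges of `E` and `Q`, enters the slow-change regime
along the filter `l`: the mean is strictly increasing, with a slope bounded away from `0`;
`σ_max → 0`; the fractional changes over a step `σ_max` tend to `0`; and the standardised densities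
do not degenerate into ever sharper peaks, in the sense that their entropy integrals are uniformly
integrable at large values of the density. -/
structure SlowChangeRegime {ι : Type*} (l : Filter ι) (eMin eMax qMin qMax : ℝ)
    (f : ι → ℝ → ℝ → ℝ) : Prop where
  isChannel : ∀ i, IsChannel eMin eMax qMin qMax (f i)
  slope : ∃ c : ℝ, 0 < c ∧ ∀ i, ∀ e ∈ Ioo eMin eMax, c ≤ deriv (mean (f i)) e
  sigmaMax_tendsto : Tendsto (fun i => sigmaMax eMin eMax (f i)) l (𝓝 0)
  slow : ∃ δ : ι → ℝ, Tendsto δ l (𝓝 0) ∧ ∀ i, HasSlowChange eMin eMax qMin qMax (δ i) (f i)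
  peaks : ∀ η : ℝ, 0 < η → ∃ B : ℝ, 1 ≤ B ∧ ∀ i, ∀ e ∈ Ioo eMin eMax,
    ∫ x in {x | B < shape (f i) e x}, shape (f i) e x * Real.logb 2 (shape (f i) e x) ≤ η

end SlowChange

/-!
# Capacity of a channel in the slow-change regime

All estimates are made in nats; write `h(e)` for the entropy of `f(·|e)`, and `φ(·|e)` for the
standardised density.

Slow change makes the standardised densities at two inputs a bounded multiple of `σ_max` apart
nearly equal in `L¹`, even with the weight `|x|` (`exists_shape_close`). The differential conditions
only give this where the output `m(r) + σ(r) x` stays inside `(q_min, q_max)` for all inputs `r` in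
between. Since that output increases with `r`, each half-line has a direction of comparison that is
always safe, and the resulting one-sided inequalities become two-sided because all the standardised
densities have mean zero. With the uniform integrability of the peaks it follows that `h` varies
slowly too (`exists_natEntropy_close`).

*Upper bound* (`exists_upper_bound`). By Gibbs' inequality the mutual information is at most
`log W + θ` if `W = ∫ exp (-H)` and `H` exceeds `h(e)` by at most `θ` on average under `f(·|e)`, for
every `e`. The function `H(q) = inf_e (h(e) + θ |q - m(e)| / σ_max)` has this property, and the
substitution `q = m(e)` gives `W ≈ ∫ m' exp (-h) = N`, because `H(m(e)) ≈ h(e)` and the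
exponential tails of `exp (-H)` outside the range of `m` have scale `σ_max / θ`, which is too short
to matter.

*Lower bound* (`exists_lower_bound`). The input density is `m' exp (-h) / N`. In the variational
formula for mutual information the posterior density of the input may be replaced by any
sub-probability kernel, and `m'(e) f(q|e)`, restricted to `|q - m(e)| ≤ X σ(e)`, is nearly one: for
fixed `q` the substitution `x = (q - m(e)) / σ(e)` turns its mass into that of a standardised density.
This gives `log N`, up to the outputs with `|q - m(e)| > X σ(e)`; for these a small multiple of a
Cauchy kernel is added, whose cost is controlled by the second moment and by the peak condition.
-/

namespace SlowChange

/-! ### Affine substitution on the line -/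

theorem integral_comp_affine (g : ℝ → ℝ) (m : ℝ) {s : ℝ} (hs : 0 < s) :
    ∫ x, s * g (m + s * x) = ∫ q, g q := by
  rw [integral_const_mul, Measure.integral_comp_mul_left (fun y => g (m + y)) s,
    integral_add_left_eq_self g m, abs_of_pos (inv_pos.2 hs), smul_eq_mul]
  field_simp

theorem integrable_comp_affine {g : ℝ → ℝ} (m : ℝ) {s : ℝ} (hs : 0 < s) (hg : Integrable g) :
    Integrable (fun x => s * g (m + s * x)) :=
  ((hg.comp_add_left m).comp_mul_left' hs.ne').const_mul s

/-- Differential entropy measured in nats. -/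
noncomputable def natEntropy (p : ℝ → ℝ) : ℝ :=
  -∫ x, p x * Real.log (p x)

theorem entropy_eq_natEntropy_div (p : ℝ → ℝ) : entropy p = natEntropy p / Real.log 2 := by
  simp only [entropy, natEntropy, Real.logb, ← mul_div_assoc, integral_div, neg_div]

theorem two_rpow_entropy (p : ℝ → ℝ) : (2 : ℝ) ^ entropy p = Real.exp (natEntropy p) := by
  rw [entropy_eq_natEntropy_div, Real.rpow_def_of_pos two_pos]
  congr 1
  field_simp

/-! ### A single conditional density -/

namespace IsChannel

variable {a b qm qM : ℝ} {f : ℝ → ℝ → ℝ} (hf : IsChannel a b qm qM f) {e : ℝ} (he : e ∈ Ioo a b)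
include hf

theorem measurable_right (e : ℝ) : Measurable (f e) :=
  hf.measurable.comp measurable_prodMk_left

include he

theorem integrable : Integrable (f e) := by
  by_contra h
  have := hf.integral_eq_one e he
  rw [integral_undef h] at this
  norm_num at this

theorem integrable_mul {g : ℝ → ℝ} (hg : Continuous g) : Integrable (fun q => f e q * g q) := by
  obtain ⟨C, hC⟩ := isCompact_Icc.exists_bound_of_continuousOn (s := Icc qm qM) hg.continuousOn
  have h := (hf.integrable he).mul_bdd (c := max C 0) (g := (Icc qm qM).indicator g)
    (hg.measurable.indicator measurableSet_Icc).aestronglyMeasurable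
    (Eventually.of_forall fun q => by
      by_cases hq : q ∈ Icc qm qM
      · simpa [hq] using Or.inl (hC q hq)
      · simp [hq])
  refine h.congr (Eventually.of_forall fun q => ?_)
  by_cases hq : q ∈ Icc qm qM
  · simp [hq]
  · simp [hq, hf.eq_zero e he q fun h => hq (Ioo_subset_Icc_self h)]

/-- A continuous function that is positive on `(qm, qM)` has a positive conditional expectation. -/
theorem integral_mul_pos {g : ℝ → ℝ} (hg : Continuous g) (Z : Set ℝ) (hZ : Z.Countable)
    (hpos : ∀ q ∈ Ioo qm qM, q ∉ Z → 0 < g q) (hnn : ∀ q ∈ Ioo qm qM, 0 ≤ g q) :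
    0 < ∫ q, f e q * g q := by
  have hnn' : ∀ q, 0 ≤ f e q * g q := fun q => by
    by_cases hq : q ∈ Ioo qm qM
    · exact mul_nonneg (hf.nonneg e he q) (hnn q hq)
    · simp [hf.eq_zero e he q hq]
  refine lt_of_le_of_ne (integral_nonneg hnn') fun h => ?_
  have h0 := (integral_eq_zero_iff_of_nonneg hnn' (hf.integrable_mul he hg)).1 h.symm
  have hz : f e =ᵐ[volume] 0 := by
    filter_upwards [h0, hZ.ae_notMem volume] with q hq hqZ
    by_cases hqI : q ∈ Ioo qm qM
    · exact (mul_eq_zero.1 hq).resolve_right (hpos q hqI hqZ).ne'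
    · exact hf.eq_zero e he q hqI
  have := hf.integral_eq_one e he
  rw [integral_congr_ae hz] at this
  simp at this

theorem mean_mem : mean f e ∈ Ioo qm qM := by
  have h1 := hf.integral_eq_one e he
  have hi := hf.integrable he
  have hq : Integrable (fun q => f e q * q) := hf.integrable_mul he continuous_id
  have hm : ∫ q, f e q * q = mean f e := by simp only [mean, mul_comm]
  constructor
  · have := hf.integral_mul_pos he (g := fun q => q - qm) (by fun_prop) ∅ countable_empty
      (fun q hq _ => sub_pos.2 hq.1) (fun q hq => (sub_pos.2 hq.1).le)
    simp only [mul_sub] at this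
    rw [integral_sub hq (hi.mul_const _), integral_mul_const, h1, hm] at this
    linarith
  · have := hf.integral_mul_pos he (g := fun q => qM - q) (by fun_prop) ∅ countable_empty
      (fun q hq _ => sub_pos.2 hq.2) (fun q hq => (sub_pos.2 hq.2).le)
    simp only [mul_sub] at this
    rw [integral_sub (hi.mul_const _) hq, integral_mul_const, h1, hm] at this
    linarith

theorem stdDev_pos : 0 < stdDev f e := by
  have := hf.integral_mul_pos he (g := fun q => (q - mean f e) ^ 2) (by fun_prop) {mean f e}
    (countable_singleton _) (fun q _ hq => by
      have : q - mean f e ≠ 0 := sub_ne_zero.2 hq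
      positivity) (fun q _ => sq_nonneg _)
  refine Real.sqrt_pos.2 ?_
  simpa only [mul_comm] using this

theorem stdDev_sq : stdDev f e ^ 2 = ∫ q, f e q * (q - mean f e) ^ 2 := by
  have : 0 ≤ ∫ q, (q - mean f e) ^ 2 * f e q :=
    integral_nonneg fun q => mul_nonneg (sq_nonneg _) (hf.nonneg e he q)
  rw [stdDev, Real.sq_sqrt this]
  simp only [mul_comm]

theorem stdDev_le : stdDev f e ≤ qM - qm := by
  have hm := hf.mean_mem he
  have hlt : 0 < qM - qm := by linarith [hm.1, hm.2]
  refine (abs_le_of_sq_le_sq' ?_ hlt.le).2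
  rw [hf.stdDev_sq he]
  calc ∫ q, f e q * (q - mean f e) ^ 2 ≤ ∫ q, f e q * (qM - qm) ^ 2 := by
        refine integral_mono (hf.integrable_mul he (by fun_prop))
          ((hf.integrable he).mul_const _) fun q => ?_
        by_cases hq : q ∈ Ioo qm qM
        · refine mul_le_mul_of_nonneg_left ?_ (hf.nonneg e he q)
          exact sq_le_sq' (by linarith [hq.1, hq.2, hm.1, hm.2])
            (by linarith [hq.1, hq.2, hm.1, hm.2])
        · simp [hf.eq_zero e he q hq]
    _ = (qM - qm) ^ 2 := by rw [integral_mul_const, hf.integral_eq_one e he, one_mul]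

theorem stdDev_le_sigmaMax : stdDev f e ≤ sigmaMax a b f :=
  le_csSup ⟨qM - qm, by rintro _ ⟨r, hr, rfl⟩; exact hf.stdDev_le hr⟩ (mem_image_of_mem _ he)

theorem sigmaMax_pos : 0 < sigmaMax a b f :=
  (hf.stdDev_pos he).trans_le (hf.stdDev_le_sigmaMax he)

/-! ### The standardised density -/

theorem shape_nonneg (x : ℝ) : 0 ≤ shape f e x :=
  mul_nonneg (hf.stdDev_pos he).le (hf.nonneg e he _)

theorem shape_eq_zero {x : ℝ} (hx : mean f e + stdDev f e * x ∉ Ioo qm qM) : shape f e x = 0 := by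
  rw [shape, hf.eq_zero e he _ hx, mul_zero]

omit he in
theorem measurable_shape (e : ℝ) : Measurable (shape f e) := by
  unfold shape
  exact ((hf.measurable_right e).comp (by fun_prop)).const_mul _

/-- Expectations under the standardised density, for functions of the standardised variable. -/
theorem integral_shape_mul (g : ℝ → ℝ) :
    ∫ x, shape f e x * g x = ∫ q, f e q * g ((q - mean f e) / stdDev f e) := by
  have hs := hf.stdDev_pos he
  rw [← integral_comp_affine (fun q => f e q * g ((q - mean f e) / stdDev f e)) (mean f e) hs]
  refine integral_congr_ae (Eventually.of_forall fun x => ?_)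
  simp only [shape, add_sub_cancel_left]
  rw [mul_div_cancel_left₀ _ hs.ne', mul_assoc]

theorem integrable_shape_mul_iff (g : ℝ → ℝ) :
    Integrable (fun x => shape f e x * g x) ↔
      Integrable (fun q => f e q * g ((q - mean f e) / stdDev f e)) := by
  have hs := hf.stdDev_pos he
  constructor
  · intro h
    have := integrable_comp_affine (-(mean f e) / stdDev f e) (inv_pos.2 hs) h
    refine this.congr (Eventually.of_forall fun q => ?_)
    have h1 : -(mean f e) / stdDev f e + (stdDev f e)⁻¹ * q = (q - mean f e) / stdDev f e := by
      field_simp; ring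
    have h2 : mean f e + stdDev f e * ((q - mean f e) / stdDev f e) = q := by
      field_simp; ring
    simp only [shape, h1, h2]
    field_simp
  · intro h
    refine (integrable_comp_affine (mean f e) hs h).congr (Eventually.of_forall fun x => ?_)
    simp only [shape, add_sub_cancel_left]
    rw [mul_div_cancel_left₀ _ hs.ne', mul_assoc]

theorem integrable_shape_mul {g : ℝ → ℝ} (hg : Continuous g) :
    Integrable (fun x => shape f e x * g x) :=
  (hf.integrable_shape_mul_iff he g).2 (hf.integrable_mul he (by fun_prop))

theorem integrable_shape : Integrable (shape f e) := by
  simpa using hf.integrable_shape_mul he (g := fun _ => 1) continuous_const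

theorem integral_shape : ∫ x, shape f e x = 1 := by
  simpa [hf.integral_eq_one e he] using hf.integral_shape_mul he (fun _ => 1)

theorem integral_shape_mul_id : ∫ x, shape f e x * x = 0 := by
  have hq : Integrable (fun q => f e q * q) := hf.integrable_mul he continuous_id
  have hm : ∫ q, f e q * q = mean f e := by simp only [mean, mul_comm]
  rw [hf.integral_shape_mul he (fun x => x)]
  simp only [← mul_div_assoc, mul_sub]
  rw [integral_div, integral_sub hq ((hf.integrable he).mul_const _), integral_mul_const,
    hf.integral_eq_one e he, hm]
  simp

theorem integral_shape_mul_sq : ∫ x, shape f e x * x ^ 2 = 1 := by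
  rw [hf.integral_shape_mul he (fun x => x ^ 2)]
  simp only [← mul_div_assoc, div_pow]
  rw [integral_div, ← hf.stdDev_sq he, div_self (pow_pos (hf.stdDev_pos he) 2).ne']

theorem integral_shape_mul_abs_le : ∫ x, shape f e x * |x| ≤ 1 := by
  have h : ∫ x, shape f e x * |x| ≤ ∫ x, (shape f e x * 1 + shape f e x * x ^ 2) * (1 / 2) := by
    refine integral_mono (hf.integrable_shape_mul he continuous_abs)
      (((hf.integrable_shape_mul he continuous_const).add
        (hf.integrable_shape_mul he (by fun_prop))).mul_const _) fun x => ?_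
    have h0 := hf.shape_nonneg he x
    have : |x| ≤ (1 + x ^ 2) * (1 / 2) := by nlinarith [sq_nonneg (|x| - 1), sq_abs x]
    calc shape f e x * |x| ≤ shape f e x * ((1 + x ^ 2) * (1 / 2)) := by gcongr
      _ = _ := by ring
  rw [integral_mul_const, integral_add (hf.integrable_shape_mul he continuous_const)
    (hf.integrable_shape_mul he (by fun_prop)), hf.integral_shape_mul_sq he] at h
  simp only [mul_one, hf.integral_shape he] at h
  linarith

/-- Chebyshev's inequality for the first moment of the standardised density. -/
theorem setIntegral_shape_mul_abs_le {R : ℝ} (hR : 0 < R) :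
    ∫ x in {x | R ≤ |x|}, shape f e x * |x| ≤ 1 / R := by
  have hm : MeasurableSet {x : ℝ | R ≤ |x|} := measurableSet_le measurable_const measurable_norm
  rw [← integral_indicator hm]
  calc _ ≤ ∫ x, shape f e x * x ^ 2 * (1 / R) := by
        refine integral_mono ((hf.integrable_shape_mul he continuous_abs).indicator hm)
          ((hf.integrable_shape_mul he (by fun_prop)).mul_const _) fun x => ?_
        have h0 := hf.shape_nonneg he x
        by_cases hx : x ∈ {x : ℝ | R ≤ |x|}
        · simp only [indicator_of_mem hx]
          have hx' : R ≤ |x| := hx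
          have : |x| ≤ x ^ 2 * (1 / R) := by
            rw [mul_one_div, le_div_iff₀ hR, ← sq_abs]; nlinarith [abs_nonneg x]
          calc shape f e x * |x| ≤ shape f e x * (x ^ 2 * (1 / R)) := by gcongr
            _ = _ := by ring
        · simp only [indicator_of_notMem hx]; positivity
    _ = 1 / R := by rw [integral_mul_const, hf.integral_shape_mul_sq he, one_mul]

/-- Chebyshev's inequality for the mass of the standardised density. -/
theorem setIntegral_shape_le {R : ℝ} (hR : 0 < R) :
    ∫ x in {x | R ≤ |x|}, shape f e x ≤ 1 / R ^ 2 := by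
  have hm : MeasurableSet {x : ℝ | R ≤ |x|} := measurableSet_le measurable_const measurable_norm
  rw [← integral_indicator hm]
  calc _ ≤ ∫ x, shape f e x * x ^ 2 * (1 / R ^ 2) := by
        refine integral_mono ((hf.integrable_shape he).indicator hm)
          ((hf.integrable_shape_mul he (by fun_prop)).mul_const _) fun x => ?_
        have h0 := hf.shape_nonneg he x
        by_cases hx : x ∈ {x : ℝ | R ≤ |x|}
        · simp only [indicator_of_mem hx]
          have hx' : R ≤ |x| := hx
          have : 1 ≤ x ^ 2 * (1 / R ^ 2) := by
            rw [mul_one_div, le_div_iff₀ (by positivity), ← sq_abs x, one_mul]; gcongr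
          calc shape f e x = shape f e x * 1 := (mul_one _).symm
            _ ≤ shape f e x * (x ^ 2 * (1 / R ^ 2)) := by gcongr
            _ = _ := by ring
        · simp only [indicator_of_notMem hx]; positivity
    _ = 1 / R ^ 2 := by rw [integral_mul_const, hf.integral_shape_mul_sq he, one_mul]

theorem integrable_mul_log : Integrable (fun q => f e q * Real.log (f e q)) := by
  have := (hf.integrable_entropy e he).mul_const (Real.log 2)
  refine this.congr (Eventually.of_forall fun q => ?_)
  have : Real.log 2 ≠ 0 := (Real.log_pos one_lt_two).ne'
  simp only [Real.logb]
  field_simp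

theorem integrable_shape_mul_log :
    Integrable (fun x => shape f e x * Real.log (shape f e x)) := by
  have hs := hf.stdDev_pos he
  have h := integrable_comp_affine (mean f e) hs
    ((hf.integrable_mul_log he).add ((hf.integrable he).mul_const (Real.log (stdDev f e))))
  refine h.congr (Eventually.of_forall fun x => ?_)
  simp only [shape, Pi.add_apply]
  rcases eq_or_ne (f e (mean f e + stdDev f e * x)) 0 with h0 | h0
  · simp [h0]
  · rw [Real.log_mul hs.ne' h0]; ring

theorem natEntropy_eq : natEntropy (f e) = Real.log (stdDev f e) + natEntropy (shape f e) := by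
  have hs := hf.stdDev_pos he
  have h := integral_comp_affine
    (fun q => f e q * Real.log (f e q) + f e q * Real.log (stdDev f e)) (mean f e) hs
  rw [integral_add (hf.integrable_mul_log he) ((hf.integrable he).mul_const _),
    integral_mul_const, hf.integral_eq_one e he] at h
  have h2 : ∫ x, shape f e x * Real.log (shape f e x) =
      ∫ x, stdDev f e * (f e (mean f e + stdDev f e * x) *
        Real.log (f e (mean f e + stdDev f e * x)) +
        f e (mean f e + stdDev f e * x) * Real.log (stdDev f e)) := by
    refine integral_congr_ae (Eventually.of_forall fun x => ?_)
    simp only [shape]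
    rcases eq_or_ne (f e (mean f e + stdDev f e * x)) 0 with h0 | h0
    · simp [h0]
    · rw [Real.log_mul hs.ne' h0]; ring
  rw [natEntropy, natEntropy, h2, h]
  ring

end IsChannel

/-! ### Slow change along the input -/

/-- Two-sided Grönwall bound for a function whose logarithmic derivative is at most `L`. -/
theorem le_exp_mul_of_abs_deriv_le {g : ℝ → ℝ} {L r s : ℝ} (hrs : r ≤ s)
    (hd : ∀ t ∈ Icc r s, DifferentiableAt ℝ g t) (hb : ∀ t ∈ Icc r s, |deriv g t| ≤ L * g t) :
    g s ≤ Real.exp (L * (s - r)) * g r ∧ g r ≤ Real.exp (L * (s - r)) * g s := by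
  have key : ∀ k t : ℝ, t ∈ Icc r s → HasDerivAt (fun t => g t * Real.exp (k * t))
      (deriv g t * Real.exp (k * t) + g t * (Real.exp (k * t) * (k * 1))) t := fun k t ht =>
    (hd t ht).hasDerivAt.mul ((hasDerivAt_id t).const_mul k).exp
  have hr : r ∈ Icc r s := left_mem_Icc.2 hrs
  have hs : s ∈ Icc r s := right_mem_Icc.2 hrs
  constructor
  · have h : AntitoneOn (fun t => g t * Real.exp (-L * t)) (Icc r s) := by
      refine antitoneOn_of_deriv_nonpos (convex_Icc r s)
        (fun t ht => (key _ t ht).continuousAt.continuousWithinAt)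
        (fun t ht => (key _ t (interior_subset ht)).differentiableAt.differentiableWithinAt)
        fun t ht => ?_
      rw [(key _ t (interior_subset ht)).deriv]
      have := (abs_le.1 (hb t (interior_subset ht))).2
      nlinarith [Real.exp_pos (-L * t)]
    have h1 : g s * Real.exp (-L * s) ≤ g r * Real.exp (-L * r) := h hr hs hrs
    calc g s = g s * Real.exp (-L * s) * Real.exp (L * s) := by
          rw [mul_assoc, ← Real.exp_add]; simp
      _ ≤ g r * Real.exp (-L * r) * Real.exp (L * s) := by gcongr
      _ = _ := by rw [mul_assoc, ← Real.exp_add, mul_comm]; ring_nf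
  · have h : MonotoneOn (fun t => g t * Real.exp (L * t)) (Icc r s) := by
      refine monotoneOn_of_deriv_nonneg (convex_Icc r s)
        (fun t ht => (key _ t ht).continuousAt.continuousWithinAt)
        (fun t ht => (key _ t (interior_subset ht)).differentiableAt.differentiableWithinAt)
        fun t ht => ?_
      rw [(key _ t (interior_subset ht)).deriv]
      have := (abs_le.1 (hb t (interior_subset ht))).1
      nlinarith [Real.exp_pos (L * t)]
    have h1 : g r * Real.exp (L * r) ≤ g s * Real.exp (L * s) := h hr hs hrs
    calc g r = g r * Real.exp (L * r) * Real.exp (-L * r) := by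
          rw [mul_assoc, ← Real.exp_add]; simp
      _ ≤ g s * Real.exp (L * s) * Real.exp (-L * r) := by gcongr
      _ = _ := by rw [mul_assoc, ← Real.exp_add, mul_comm]; ring_nf

/-- A channel with slow change at rate `δ` whose mean has slope at least `c > 0`. -/
structure SlowChannel (eMin eMax qMin qMax c δ : ℝ) (f : ℝ → ℝ → ℝ) : Prop where
  lt : eMin < eMax
  isChannel : IsChannel eMin eMax qMin qMax f
  slow : HasSlowChange eMin eMax qMin qMax δ f
  slope_pos : 0 < c
  le_slope : ∀ e ∈ Ioo eMin eMax, c ≤ deriv (mean f) e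

namespace SlowChannel

variable {a b qm qM c δ : ℝ} {f : ℝ → ℝ → ℝ} (h : SlowChannel a b qm qM c δ f)
include h

theorem midpoint_mem : (a + b) / 2 ∈ Ioo a b := by
  constructor <;> linarith [h.lt]

theorem sigmaMax_pos : 0 < sigmaMax a b f :=
  h.isChannel.sigmaMax_pos h.midpoint_mem

theorem delta_nonneg : 0 ≤ δ := by
  have he := h.midpoint_mem
  have h1 := h.slow.deriv_mean_slow _ he
  have h2 := h.slope_pos.trans_le (h.le_slope _ he)
  have h3 : 0 ≤ δ * deriv (mean f) ((a + b) / 2) :=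
    (mul_nonneg h.sigmaMax_pos.le (abs_nonneg _)).trans h1
  exact nonneg_of_mul_nonneg_left h3 h2

theorem abs_deriv_stdDev_le {e : ℝ} (he : e ∈ Ioo a b) : |deriv (stdDev f) e| ≤ δ := by
  have h1 := h.slow.stdDev_slow e he
  have h2 := mul_le_mul_of_nonneg_left (h.isChannel.stdDev_le_sigmaMax he) h.delta_nonneg
  have h3 : sigmaMax a b f * |deriv (stdDev f) e| ≤ sigmaMax a b f * δ := by linarith
  exact le_of_mul_le_mul_left h3 h.sigmaMax_pos

theorem log_stdDev_sub_le {e e' : ℝ} (he : e ∈ Ioo a b) (he' : e' ∈ Ioo a b) :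
    |Real.log (stdDev f e) - Real.log (stdDev f e')| ≤ δ / sigmaMax a b f * |e - e'| := by
  wlog hle : e ≤ e' generalizing e e'
  · rw [abs_sub_comm, abs_sub_comm e]
    exact this he' he (le_of_not_ge hle)
  have hsub : Icc e e' ⊆ Ioo a b := Icc_subset_Ioo he.1 he'.2
  have hs := h.sigmaMax_pos
  have hG := le_exp_mul_of_abs_deriv_le (L := δ / sigmaMax a b f) hle
    (fun t ht => h.slow.stdDev_differentiable t (hsub ht)) fun t ht => by
      rw [div_mul_eq_mul_div, le_div_iff₀ hs, mul_comm]
      exact h.slow.stdDev_slow t (hsub ht)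
  have p := h.isChannel.stdDev_pos he
  have p' := h.isChannel.stdDev_pos he'
  have h1 := Real.log_le_log p' hG.1
  have h2 := Real.log_le_log p hG.2
  rw [Real.log_mul (Real.exp_pos _).ne' p.ne', Real.log_exp] at h1
  rw [Real.log_mul (Real.exp_pos _).ne' p'.ne', Real.log_exp] at h2
  rw [abs_sub_comm e, abs_of_nonneg (sub_nonneg.2 hle), abs_le]
  constructor <;> linarith

/-- For a fixed standardised output `x` that is not too large, the output itself increases with the
input. -/
theorem strictMonoOn_output {x : ℝ} (hx : δ * |x| < c) :
    StrictMonoOn (fun r => mean f r + stdDev f r * x) (Ioo a b) := by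
  have hd : ∀ r ∈ Ioo a b, HasDerivAt (fun r => mean f r + stdDev f r * x)
      (deriv (mean f) r + deriv (stdDev f) r * x) r := fun r hr =>
    (h.slow.mean_differentiable r hr).hasDerivAt.add
      ((h.slow.stdDev_differentiable r hr).hasDerivAt.mul_const x)
  refine strictMonoOn_of_deriv_pos (convex_Ioo a b)
    (fun r hr => (hd r hr).continuousAt.continuousWithinAt) fun r hr => ?_
  rw [interior_Ioo] at hr
  rw [(hd r hr).deriv]
  have h1 : |deriv (stdDev f) r * x| ≤ δ * |x| := by
    rw [abs_mul]; gcongr; exact h.abs_deriv_stdDev_le hr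
  linarith [h.le_slope r hr, (abs_le.1 h1).1]

theorem strictMonoOn_mean : StrictMonoOn (mean f) (Ioo a b) := by
  simpa using h.strictMonoOn_output (x := 0) (by simpa using h.slope_pos)

theorem mul_abs_sub_le {e e' : ℝ} (he : e ∈ Ioo a b) (he' : e' ∈ Ioo a b) :
    c * |e - e'| ≤ |mean f e - mean f e'| := by
  wlog hle : e' ≤ e generalizing e e'
  · rw [abs_sub_comm, abs_sub_comm (mean f e)]
    exact this he' he (le_of_not_ge hle)
  have h1 := (convex_Ioo a b).mul_sub_le_image_sub_of_le_deriv (f := mean f) (C := c)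
    (fun r hr => (h.slow.mean_differentiable r hr).continuousAt.continuousWithinAt)
    (fun r hr => (h.slow.mean_differentiable r (interior_subset hr)).differentiableWithinAt)
    (fun r hr => h.le_slope r (interior_subset hr)) e' he' e he hle
  rw [abs_of_nonneg (sub_nonneg.2 hle)]
  exact h1.trans (le_abs_self _)

/-- Comparison in both directions at a standardised output `x` for which the output stays inside its
range at all inputs in between. -/
theorem shape_le_exp_mul_shape {e e' x : ℝ} (hle : e ≤ e') (he : e ∈ Ioo a b) (he' : e' ∈ Ioo a b)
    (hpath : ∀ r ∈ Icc e e', mean f r + stdDev f r * x ∈ Ioo qm qM) :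
    shape f e' x ≤ Real.exp (δ / sigmaMax a b f * (e' - e)) * shape f e x ∧
      shape f e x ≤ Real.exp (δ / sigmaMax a b f * (e' - e)) * shape f e' x := by
  have hsub : Icc e e' ⊆ Ioo a b := Icc_subset_Ioo he.1 he'.2
  refine le_exp_mul_of_abs_deriv_le (g := fun r => shape f r x) hle
    (fun t ht => h.slow.shape_differentiable t (hsub ht) x (hpath t ht)) fun t ht => ?_
  rw [div_mul_eq_mul_div, le_div_iff₀ h.sigmaMax_pos, mul_comm]
  exact h.slow.shape_slow t (hsub ht) x (hpath t ht)

/-- To the right of the mean, moving the input down keeps the output inside its range, so that the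
standardised densities at the two inputs can be compared. -/
theorem shape_le_of_nonneg {e e' x : ℝ} (hle : e ≤ e') (he : e ∈ Ioo a b) (he' : e' ∈ Ioo a b)
    (hx0 : 0 ≤ x) (hx : δ * |x| < c) :
    shape f e' x ≤ Real.exp (δ / sigmaMax a b f * (e' - e)) * shape f e x := by
  by_cases hr : mean f e' + stdDev f e' * x ∈ Ioo qm qM
  · refine (h.shape_le_exp_mul_shape hle he he' fun r hr' => ?_).1
    have hrI : r ∈ Ioo a b := Icc_subset_Ioo he.1 he'.2 hr'
    have h1 := (h.strictMonoOn_output hx).monotoneOn hrI he' hr'.2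
    have h2 := mul_nonneg (h.isChannel.stdDev_pos hrI).le hx0
    exact ⟨by linarith [(h.isChannel.mean_mem hrI).1], h1.trans_lt hr.2⟩
  · rw [h.isChannel.shape_eq_zero he' hr]
    exact mul_nonneg (Real.exp_pos _).le (h.isChannel.shape_nonneg he x)

/-- To the left of the mean, moving the input up keeps the output inside its range. -/
theorem shape_le_of_nonpos {e e' x : ℝ} (hle : e ≤ e') (he : e ∈ Ioo a b) (he' : e' ∈ Ioo a b)
    (hx0 : x ≤ 0) (hx : δ * |x| < c) :
    shape f e x ≤ Real.exp (δ / sigmaMax a b f * (e' - e)) * shape f e' x := by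
  by_cases hr : mean f e + stdDev f e * x ∈ Ioo qm qM
  · refine (h.shape_le_exp_mul_shape hle he he' fun r hr' => ?_).2
    have hrI : r ∈ Ioo a b := Icc_subset_Ioo he.1 he'.2 hr'
    have h1 := (h.strictMonoOn_output hx).monotoneOn he hrI hr'.1
    have h2 := mul_nonpos_of_nonneg_of_nonpos (h.isChannel.stdDev_pos hrI).le hx0
    exact ⟨hr.1.trans_le h1, by linarith [(h.isChannel.mean_mem hrI).2]⟩
  · rw [h.isChannel.shape_eq_zero he hr]
    exact mul_nonneg (Real.exp_pos _).le (h.isChannel.shape_nonneg he' x)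

end SlowChannel

/-! ### Elementary inequalities and Laplace integrals -/

/-- `g` is integrable with integral `v`; this keeps integrability and value together through sums
and multiples. -/
def HasIntegralValue (g : ℝ → ℝ) (v : ℝ) : Prop :=
  Integrable g ∧ ∫ x, g x = v

theorem _root_.MeasureTheory.Integrable.hasIntegralValue {g : ℝ → ℝ} (hg : Integrable g) :
    HasIntegralValue g (∫ x, g x) :=
  ⟨hg, rfl⟩

namespace HasIntegralValue

variable {g g' : ℝ → ℝ} {v v' : ℝ}

theorem add (h : HasIntegralValue g v) (h' : HasIntegralValue g' v') :
    HasIntegralValue (fun x => g x + g' x) (v + v') :=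
  ⟨h.1.add h'.1, by rw [integral_add h.1 h'.1, h.2, h'.2]⟩

theorem sub (h : HasIntegralValue g v) (h' : HasIntegralValue g' v') :
    HasIntegralValue (fun x => g x - g' x) (v - v') :=
  ⟨h.1.sub h'.1, by rw [integral_sub h.1 h'.1, h.2, h'.2]⟩

theorem const_mul (h : HasIntegralValue g v) (k : ℝ) :
    HasIntegralValue (fun x => k * g x) (k * v) :=
  ⟨h.1.const_mul k, by rw [integral_const_mul, h.2]⟩

theorem mul_const (h : HasIntegralValue g v) (k : ℝ) :
    HasIntegralValue (fun x => g x * k) (v * k) :=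
  ⟨h.1.mul_const k, by rw [integral_mul_const, h.2]⟩

theorem mono (h : HasIntegralValue g v) (h' : HasIntegralValue g' v') (hle : ∀ x, g x ≤ g' x) :
    v ≤ v' :=
  h.2 ▸ h'.2 ▸ integral_mono h.1 h'.1 hle

end HasIntegralValue

/-- The tangent-line inequality behind Gibbs' inequality. -/
theorem mul_log_le_mul_log_add {p r : ℝ} (hp : 0 ≤ p) (hr : 0 < r) :
    p * Real.log r ≤ p * Real.log p + r - p := by
  rcases hp.eq_or_lt with rfl | hp
  · simpa using hr.le
  · have h := Real.log_le_sub_one_of_pos (div_pos hr hp)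
    rw [Real.log_div hr.ne' hp.ne'] at h
    have h2 := mul_le_mul_of_nonneg_left h hp.le
    have h3 : p * (r / p - 1) = r - p := by field_simp
    linarith

theorem integral_exp_neg_mul_abs {k : ℝ} (hk : 0 < k) :
    ∫ x : ℝ, Real.exp (-k * |x|) = 2 / k := by
  rw [integral_comp_abs (f := fun x => Real.exp (-k * x)),
    integral_exp_mul_Ioi (neg_lt_zero.2 hk)]
  simp
  field_simp

theorem integrable_exp_neg_mul_abs {k : ℝ} (hk : 0 < k) :
    Integrable (fun x : ℝ => Real.exp (-k * |x|)) :=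
  .of_integral_ne_zero (by rw [integral_exp_neg_mul_abs hk]; positivity)

theorem integrable_laplace : Integrable (fun x : ℝ => Real.exp (-|x|) / 2) := by
  simpa using (integrable_exp_neg_mul_abs one_pos).div_const 2

theorem integral_laplace : ∫ x : ℝ, Real.exp (-|x|) / 2 = 1 := by
  have := integral_exp_neg_mul_abs one_pos
  simp only [neg_mul, one_mul, div_one] at this
  rw [integral_div, this]
  norm_num

/-- The part of the entropy integral (in nats) of the standardised densities that comes from values
of the density above `B` is at most `η`. -/
def PeakBound (eMin eMax B η : ℝ) (f : ℝ → ℝ → ℝ) : Prop :=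
  ∀ e ∈ Ioo eMin eMax,
    ∫ x in {x | B < shape f e x}, shape f e x * Real.log (shape f e x) ≤ η

namespace IsChannel

variable {a b qm qM B η : ℝ} {f : ℝ → ℝ → ℝ} (hf : IsChannel a b qm qM f) {e : ℝ}
  (he : e ∈ Ioo a b)
include hf

theorem measurableSet_peak (B e : ℝ) : MeasurableSet {x | B < shape f e x} :=
  measurableSet_lt measurable_const (hf.measurable_shape e)

omit hf in
theorem peak_nonneg (hB : 1 ≤ B) (x : ℝ) :
    0 ≤ {x | B < shape f e x}.indicator (fun x => shape f e x * Real.log (shape f e x)) x := by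
  refine indicator_nonneg (fun x hx => ?_) x
  have h1 : 1 ≤ shape f e x := hB.trans (le_of_lt hx)
  exact mul_nonneg (by linarith) (Real.log_nonneg h1)

include he

theorem integrable_peak : Integrable
    ({x | B < shape f e x}.indicator fun x => shape f e x * Real.log (shape f e x)) :=
  (hf.integrable_shape_mul_log he).indicator (hf.measurableSet_peak B e)

theorem integral_peak_le (hp : PeakBound a b B η f) :
    ∫ x, {x | B < shape f e x}.indicator (fun x => shape f e x * Real.log (shape f e x)) x ≤ η := by
  rw [integral_indicator (hf.measurableSet_peak B e)]
  exact hp e he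

omit he in
theorem shape_mul_log_le (he : e ∈ Ioo a b) (hB : 1 ≤ B) (x : ℝ) :
    shape f e x * Real.log (shape f e x) ≤
      {x | B < shape f e x}.indicator (fun x => shape f e x * Real.log (shape f e x)) x +
        shape f e x * Real.log B := by
  have h0 := hf.shape_nonneg he x
  by_cases hx : B < shape f e x
  · rw [indicator_of_mem (show x ∈ {x | B < shape f e x} from hx)]
    have := mul_nonneg h0 (Real.log_nonneg hB)
    linarith
  · rw [indicator_of_notMem (show x ∉ {x | B < shape f e x} from hx), zero_add]
    rcases h0.eq_or_lt with h00 | h00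
    · simp [← h00]
    · exact mul_le_mul_of_nonneg_left (Real.log_le_log h00 (not_lt.1 hx)) h0

theorem natEntropy_shape_le : natEntropy (shape f e) ≤ 2 := by
  have i1 : HasIntegralValue (shape f e) 1 := ⟨hf.integrable_shape he, hf.integral_shape he⟩
  have h := (((i1.mul_const (1 - Real.log 2)).sub
    (hf.integrable_shape_mul he continuous_abs).hasIntegralValue).sub
    ⟨integrable_laplace, integral_laplace⟩).mono
    (hf.integrable_shape_mul_log he).hasIntegralValue fun x => by
      have := mul_log_le_mul_log_add (hf.shape_nonneg he x)
        (show 0 < Real.exp (-|x|) / 2 by positivity)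
      rw [Real.log_div (Real.exp_pos _).ne' two_ne_zero, Real.log_exp] at this
      linarith
  have h1 := hf.integral_shape_mul_abs_le he
  have h2 := Real.log_two_lt_d9
  rw [natEntropy]
  linarith

theorem le_natEntropy_shape (hB : 1 ≤ B) (hp : PeakBound a b B η f) :
    -(η + Real.log B) ≤ natEntropy (shape f e) := by
  have i1 : HasIntegralValue (shape f e) 1 := ⟨hf.integrable_shape he, hf.integral_shape he⟩
  have h := (hf.integrable_shape_mul_log he).hasIntegralValue.mono
    ((hf.integrable_peak he (B := B)).hasIntegralValue.add (i1.mul_const (Real.log B)))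
    (hf.shape_mul_log_le he hB)
  have := hf.integral_peak_le he hp
  rw [natEntropy]
  linarith

/-- Total variation from the weighted total variation: near `0`, where the weight is useless, the
peak bound says that the densities have little mass. -/
theorem integral_abs_shape_sub_le (hB : 3 ≤ B) (hp : PeakBound a b B η f) {e' t τ : ℝ}
    (he' : e' ∈ Ioo a b) (ht : 0 < t) (hτ : ∫ x, |shape f e x - shape f e' x| * |x| ≤ τ) :
    ∫ x, |shape f e x - shape f e' x| ≤ τ / t + 2 * t * B + 2 * η := by
  have hd := (hf.integrable_shape he).sub (hf.integrable_shape he')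
  have hw : Integrable (fun x => |shape f e x - shape f e' x| * |x|) := by
    refine ((hf.integrable_shape_mul he continuous_id).sub
      (hf.integrable_shape_mul he' continuous_id)).abs.congr (Eventually.of_forall fun x => ?_)
    simp [← sub_mul, abs_mul]
  have hc : Integrable ((Icc (-t) t).indicator fun _ : ℝ => B) :=
    (integrable_indicator_iff measurableSet_Icc).2 (integrableOn_const (by simp))
  have h := HasIntegralValue.mono (hd.abs.hasIntegralValue)
    (((hw.hasIntegralValue.mul_const t⁻¹).add hc.hasIntegralValue).add
      ((hf.integrable_peak he (B := B)).hasIntegralValue.add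
        (hf.integrable_peak he' (B := B)).hasIntegralValue)) fun x => ?_
  · rw [integral_indicator measurableSet_Icc, setIntegral_const, ← div_eq_mul_inv] at h
    simp only [Pi.sub_apply] at h
    have h1 := hf.integral_peak_le he hp
    have h2 := hf.integral_peak_le he' hp
    have h3 : (∫ x, |shape f e x - shape f e' x| * |x|) / t ≤ τ / t := by gcongr
    have h4 : volume.real (Icc (-t) t) • B = 2 * t * B := by
      rw [Real.volume_real_Icc_of_le (by linarith), smul_eq_mul]; ring
    rw [h4] at h
    linarith
  · have key : ∀ r ∈ Ioo a b, shape f r x ≤ B + {x | B < shape f r x}.indicator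
        (fun x => shape f r x * Real.log (shape f r x)) x := fun r hr => by
      by_cases hx : B < shape f r x
      · rw [indicator_of_mem (show x ∈ {x | B < shape f r x} from hx)]
        have h1 : 1 ≤ Real.log (shape f r x) := by
          rw [Real.le_log_iff_exp_le (by linarith)]
          linarith [Real.exp_one_lt_d9]
        nlinarith
      · rw [indicator_of_notMem (show x ∉ {x | B < shape f r x} from hx)]
        linarith
    have p1 := peak_nonneg (f := f) (B := B) (e := e) (by linarith) x
    have p2 := peak_nonneg (f := f) (B := B) (e := e') (by linarith) x
    have n1 := hf.shape_nonneg he x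
    have n2 := hf.shape_nonneg he' x
    have k1 := key e he
    have k2 := key e' he'
    simp only [Pi.sub_apply, ← div_eq_mul_inv]
    by_cases hx : x ∈ Icc (-t) t
    · rw [indicator_of_mem hx]
      have : 0 ≤ |shape f e x - shape f e' x| * |x| / t := by positivity
      have : |shape f e x - shape f e' x| ≤
          B + ({x | B < shape f e x}.indicator (fun x => shape f e x * Real.log (shape f e x)) x +
          {x | B < shape f e' x}.indicator (fun x => shape f e' x * Real.log (shape f e' x)) x) :=
        abs_le.2 ⟨by linarith, by linarith⟩
      linarith
    · rw [indicator_of_notMem hx]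
      have hx' : t ≤ |x| := by
        by_contra hlt
        exact hx (abs_le.1 (not_le.1 hlt).le)
      have : |shape f e x - shape f e' x| ≤ |shape f e x - shape f e' x| * |x| / t := by
        rw [le_div_iff₀ ht]; gcongr
      linarith

/-- The entropy of the standardised density is controlled by total variation, weighted total
variation, and the peaks. The comparison density is a mixture of the one at `e` with a little
Laplace density, which keeps its logarithm from becoming too negative. -/
theorem natEntropy_shape_sub_le (hB : 1 ≤ B) (hp : PeakBound a b B η f) {e' ε : ℝ}
    (he' : e' ∈ Ioo a b) (hε : 0 < ε) (hε1 : ε < 1) :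
    natEntropy (shape f e') - natEntropy (shape f e) ≤
      η + (Real.log B + Real.log (2 / ε)) * (∫ x, |shape f e x - shape f e' x|) +
        (∫ x, |shape f e x - shape f e' x| * |x|) - Real.log (1 - ε) := by
  have i1 := hf.integrable_shape he
  have i2 := hf.integrable_shape he'
  have hd : Integrable (fun x => |shape f e x - shape f e' x|) := (i1.sub i2).abs
  have hw : Integrable (fun x => |shape f e x - shape f e' x| * |x|) := by
    refine ((hf.integrable_shape_mul he continuous_id).sub
      (hf.integrable_shape_mul he' continuous_id)).abs.congr (Eventually.of_forall fun x => ?_)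
    simp [← sub_mul, abs_mul]
  set C := Real.log B + Real.log (2 / ε) with hC
  have hlog2ε : 0 ≤ Real.log (2 / ε) := Real.log_nonneg (by rw [le_div_iff₀ hε]; linarith)
  have hlogB : 0 ≤ Real.log B := Real.log_nonneg hB
  have j1 : HasIntegralValue (shape f e) 1 := ⟨i1, hf.integral_shape he⟩
  have j2 : HasIntegralValue (shape f e') 1 := ⟨i2, hf.integral_shape he'⟩
  have jk : HasIntegralValue (fun x => Real.exp (-|x|) / 2) 1 :=
    ⟨integrable_laplace, integral_laplace⟩
  have h := ((hf.integrable_shape_mul_log he).hasIntegralValue.sub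
    (hf.integrable_shape_mul_log he').hasIntegralValue).mono
    ((((hf.integrable_peak he (B := B)).hasIntegralValue.add
      ((hd.hasIntegralValue.const_mul C).add hw.hasIntegralValue)).add
      (j1.mul_const (-Real.log (1 - ε)))).add
      (((j1.const_mul (1 - ε)).add (jk.const_mul ε)).sub j2)) fun x => ?_
  · have := hf.integral_peak_le he hp
    simp only [natEntropy]
    linarith
  · have n1 := hf.shape_nonneg he x
    have n2 := hf.shape_nonneg he' x
    have hpk := peak_nonneg (f := f) (B := B) (e := e) hB x
    set u := shape f e x with hu
    set v := shape f e' x with hv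
    set k := Real.exp (-|x|) / 2 with hk
    have hkpos : 0 < k := by positivity
    have hk1 : k ≤ 1 := by
      have : Real.exp (-|x|) ≤ 1 := Real.exp_le_one_iff.2 (by simp)
      linarith
    set ψ := (1 - ε) * u + ε * k with hψ
    have hψpos : 0 < ψ := by have := mul_nonneg (sub_nonneg.2 hε1.le) n1; positivity
    have hlow : -(Real.log (2 / ε) + |x|) ≤ Real.log ψ := by
      have h1 : Real.log (ε * k) ≤ Real.log ψ := Real.log_le_log (by positivity)
        (by have := mul_nonneg (sub_nonneg.2 hε1.le) n1; linarith)
      rw [hk, Real.log_mul hε.ne' (by positivity), Real.log_div (Real.exp_pos _).ne' two_ne_zero,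
        Real.log_exp] at h1
      rw [Real.log_div two_ne_zero hε.ne']
      linarith
    have g1 : v * Real.log ψ ≤ v * Real.log v + ψ - v := mul_log_le_mul_log_add n2 hψpos
    have g2 : u * Real.log u + u * Real.log (1 - ε) ≤ u * Real.log ψ := by
      rcases n1.eq_or_lt with h0 | h0
      · simp [← h0]
      · rw [← mul_add, ← Real.log_mul h0.ne' (by linarith)]
        refine mul_le_mul_of_nonneg_left (Real.log_le_log (mul_pos h0 (by linarith)) ?_) n1
        have : 0 ≤ ε * k := by positivity
        linarith
    have g3 : (u - v) * Real.log ψ ≤ {x | B < shape f e x}.indicator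
        (fun x => shape f e x * Real.log (shape f e x)) x + (C * |u - v| + |u - v| * |x|) := by
      have habs : (u - v) * Real.log ψ ≤ |u - v| * |Real.log ψ| := by
        rw [← abs_mul]; exact le_abs_self _
      have gen : |Real.log ψ| ≤ C + |x| → (u - v) * Real.log ψ ≤ {x | B < shape f e x}.indicator
        (fun x => shape f e x * Real.log (shape f e x)) x + (C * |u - v| + |u - v| * |x|) := by
        intro hl
        have := mul_le_mul_of_nonneg_left hl (abs_nonneg (u - v))
        linarith
      by_cases hx : B < u
      · by_cases h1 : 1 ≤ ψ
        · rw [indicator_of_mem (show x ∈ {x | B < shape f e x} from hx)]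
          have hψu : ψ ≤ u := by nlinarith
          have l0 := Real.log_nonneg h1
          have l1 := Real.log_le_log hψpos hψu
          have : 0 ≤ C * |u - v| + |u - v| * |x| := by positivity
          have : v * Real.log ψ ≥ 0 := mul_nonneg n2 l0
          have : u * Real.log ψ ≤ u * Real.log u := mul_le_mul_of_nonneg_left l1 n1
          simp only [← hu]
          linarith
        · refine gen (abs_le.2 ⟨by linarith, ?_⟩)
          have := Real.log_nonpos hψpos.le (not_le.1 h1).le
          have := abs_nonneg x
          linarith
      · refine gen (abs_le.2 ⟨by linarith, ?_⟩)
        have hψB : ψ ≤ B := by nlinarith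
        have := Real.log_le_log hψpos hψB
        have := abs_nonneg x
        linarith
    linarith

end IsChannel

namespace SlowChannel

variable {a b qm qM c δ : ℝ} {f : ℝ → ℝ → ℝ} (h : SlowChannel a b qm qM c δ f)
include h

/-- Weighted total variation between the standardised densities at two inputs. The comparison of
the densities is one-sided on each half-line, but both have mean zero, so the one-sided excesses on
the two half-lines add up to almost nothing. -/
theorem integral_abs_shape_sub_mul_abs_le {e e' R κ : ℝ} (he : e ∈ Ioo a b) (he' : e' ∈ Ioo a b)
    (hR : 0 < R) (hδR : δ * R < c) (hκ : δ / sigmaMax a b f * |e - e'| ≤ κ) :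
    ∫ x, |shape f e x - shape f e' x| * |x| ≤
      3 * (Real.exp κ - 1) + 4 * Real.exp κ / R := by
  wlog hle : e ≤ e' generalizing e e'
  · have := this he' he (by rwa [abs_sub_comm]) (le_of_not_ge hle)
    simpa only [abs_sub_comm] using this
  have hf := h.isChannel
  set E := Real.exp κ with hE
  have hE1 : 1 ≤ E := Real.one_le_exp ((mul_nonneg (div_nonneg h.delta_nonneg
    h.sigmaMax_pos.le) (abs_nonneg _)).trans hκ)
  have hEE : Real.exp (δ / sigmaMax a b f * (e' - e)) ≤ E := by
    rw [abs_sub_comm, abs_of_nonneg (sub_nonneg.2 hle)] at hκ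
    exact Real.exp_le_exp.2 hκ
  have hm : MeasurableSet {x : ℝ | R ≤ |x|} := measurableSet_le measurable_const measurable_norm
  have a1 := hf.integrable_shape_mul he continuous_abs
  have a2 := hf.integrable_shape_mul he' continuous_abs
  have b1 := hf.integrable_shape_mul he continuous_id
  have b2 := hf.integrable_shape_mul he' continuous_id
  simp only [id] at b1 b2
  have hw : Integrable (fun x => |shape f e x - shape f e' x| * |x|) := by
    refine (b1.sub b2).abs.congr (Eventually.of_forall fun x => ?_)
    simp [← sub_mul, abs_mul]
  have hint := hw.hasIntegralValue.mono
    (((HasIntegralValue.sub ⟨b1, hf.integral_shape_mul_id he⟩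
      ⟨b2, hf.integral_shape_mul_id he'⟩).const_mul ((E + 1) / 2)).add
    ((a1.hasIntegralValue.add a2.hasIntegralValue).const_mul (3 / 2 * (E - 1))) |>.add
    (((a1.indicator hm).hasIntegralValue.add (a2.indicator hm).hasIntegralValue).const_mul
      (2 * E))) fun x => ?_
  · rw [integral_indicator hm, integral_indicator hm] at hint
    have t1 := hf.setIntegral_shape_mul_abs_le he hR
    have t2 := hf.setIntegral_shape_mul_abs_le he' hR
    have s1 := hf.integral_shape_mul_abs_le he
    have s2 := hf.integral_shape_mul_abs_le he'
    refine hint.trans ?_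
    have e1 : 3 / 2 * (E - 1) * ((∫ x, shape f e x * |x|) + ∫ x, shape f e' x * |x|) ≤
        3 / 2 * (E - 1) * (1 + 1) := by
      have : 0 ≤ E - 1 := by linarith
      gcongr
    have e2 : 2 * E * ((∫ x in {x | R ≤ |x|}, shape f e x * |x|) +
        ∫ x in {x | R ≤ |x|}, shape f e' x * |x|) ≤ 2 * E * (1 / R + 1 / R) := by gcongr
    have e3 : 2 * E * (1 / R + 1 / R) = 4 * E / R := by ring
    linarith
  · have n1 := hf.shape_nonneg he x
    have n2 := hf.shape_nonneg he' x
    by_cases hx : R ≤ |x|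
    · rw [indicator_of_mem (show x ∈ {x : ℝ | R ≤ |x|} from hx),
        indicator_of_mem (show x ∈ {x : ℝ | R ≤ |x|} from hx)]
      set u := shape f e x
      set v := shape f e' x
      have h1 : |u - v| ≤ u + v := abs_le.2 ⟨by linarith, by linarith⟩
      have h2 : -((u + v) * |x|) ≤ u * x - v * x := by
        have : |(u - v) * x| ≤ (u + v) * |x| := by rw [abs_mul]; gcongr
        have := (abs_le.1 this).1
        linarith
      have h3 : |u - v| * |x| ≤ (u + v) * |x| := by gcongr
      have h4 : 0 ≤ (u + v) * |x| := by positivity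
      nlinarith
    · rw [indicator_of_notMem (show x ∉ {x : ℝ | R ≤ |x|} from hx),
        indicator_of_notMem (show x ∉ {x : ℝ | R ≤ |x|} from hx)]
      have hδx : δ * |x| < c :=
        (mul_le_mul_of_nonneg_left (not_le.1 hx).le h.delta_nonneg).trans_lt hδR
      rcases le_total 0 x with hx0 | hx0
      · have h1 : shape f e' x ≤ E * shape f e x :=
          (h.shape_le_of_nonneg hle he he' hx0 hδx).trans (by gcongr)
        rw [abs_of_nonneg hx0]
        set u := shape f e x
        set v := shape f e' x
        have h2 : |u - v| ≤ (E * u - v) + (E - 1) * (u + v) :=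
          abs_le.2 ⟨by nlinarith, by nlinarith⟩
        have := mul_le_mul_of_nonneg_right h2 hx0
        linarith
      · have h1 : shape f e x ≤ E * shape f e' x :=
          (h.shape_le_of_nonpos hle he he' hx0 hδx).trans (by gcongr)
        rw [abs_of_nonpos hx0]
        set u := shape f e x
        set v := shape f e' x
        have h2 : |u - v| ≤ (E * v - u) + (E - 1) * (u + v) :=
          abs_le.2 ⟨by nlinarith, by nlinarith⟩
        have := mul_le_mul_of_nonneg_right h2 (neg_nonneg.2 hx0)
        linarith

end SlowChannel

/-- The standardised density hardly changes when the input moves by a bounded multiple of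
`σ_max`. -/
theorem exists_shape_close (c : ℝ) (hc : 0 < c) (Bf : ℝ → ℝ) (hBf : ∀ η, 0 < η → 3 ≤ Bf η)
    {K τ : ℝ} (hK : 0 < K) (hτ : 0 < τ) :
    ∃ δ₀ > 0, ∀ (a b qm qM δ : ℝ) (f : ℝ → ℝ → ℝ), SlowChannel a b qm qM c δ f → δ ≤ δ₀ →
      (∀ η, 0 < η → PeakBound a b (Bf η) η f) → ∀ e ∈ Ioo a b, ∀ e' ∈ Ioo a b,
        |e - e'| ≤ K * sigmaMax a b f →
          ∫ x, |shape f e x - shape f e' x| ≤ τ ∧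
            ∫ x, |shape f e x - shape f e' x| * |x| ≤ τ := by
  set η := τ / 8 with hη
  have hη0 : 0 < η := by positivity
  set B := Bf η
  have hB : 3 ≤ B := hBf η hη0
  set t := τ / (8 * B) with ht
  have ht0 : 0 < t := by positivity
  set τ₁ := min τ (t * τ / 4) with hτ₁
  have hτ₁0 : 0 < τ₁ := by positivity
  set y := min 1 (τ₁ / 6) with hy
  have hy0 : 0 < y := by positivity
  have hlog : 0 < Real.log (1 + y) := Real.log_pos (by linarith)
  refine ⟨min (Real.log (1 + y) / K) (c / (2 * (16 / τ₁))), by positivity, ?_⟩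
  intro a b qm qM δ f h hδ hp e he e' he' hee
  have hσ := h.sigmaMax_pos
  have hκ : δ / sigmaMax a b f * |e - e'| ≤ Real.log (1 + y) := by
    calc δ / sigmaMax a b f * |e - e'| ≤ δ / sigmaMax a b f * (K * sigmaMax a b f) := by
          gcongr; exact div_nonneg h.delta_nonneg hσ.le
      _ = δ * K := by field_simp
      _ ≤ Real.log (1 + y) / K * K := by gcongr; exact hδ.trans (min_le_left _ _)
      _ = _ := by field_simp
  have hδR : δ * (16 / τ₁) < c := by
    calc δ * (16 / τ₁) ≤ c / (2 * (16 / τ₁)) * (16 / τ₁) := by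
          gcongr; exact hδ.trans (min_le_right _ _)
      _ = c / 2 := by field_simp
      _ < c := by linarith
  have hw := h.integral_abs_shape_sub_mul_abs_le he he' (by positivity) hδR hκ
  rw [Real.exp_log (by linarith)] at hw
  have hw' : ∫ x, |shape f e x - shape f e' x| * |x| ≤ τ₁ := by
    refine hw.trans ?_
    have y1 : y ≤ 1 := min_le_left _ _
    have y2 : y ≤ τ₁ / 6 := min_le_right _ _
    have : 4 * (1 + y) / (16 / τ₁) = (1 + y) * τ₁ / 4 := by field_simp; norm_num
    rw [this]
    nlinarith
  refine ⟨?_, hw'.trans (min_le_left _ _)⟩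
  refine (h.isChannel.integral_abs_shape_sub_le he hB (hp η hη0) he' ht0 hw').trans ?_
  have h1 : τ₁ / t ≤ τ / 4 := by
    rw [div_le_iff₀ ht0]; exact (min_le_right _ _).trans (by linarith)
  have h2 : 2 * t * B = τ / 4 := by rw [ht]; field_simp; norm_num
  linarith

/-! ### Slow change of the conditional entropy -/

/-- The conditional entropy hardly changes when the input moves by at most `σ_max`. -/
theorem exists_natEntropy_close (c : ℝ) (hc : 0 < c) (Bf : ℝ → ℝ) (hBf : ∀ η, 0 < η → 3 ≤ Bf η)
    {ω : ℝ} (hω : 0 < ω) :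
    ∃ δ₀ > 0, ∀ (a b qm qM δ : ℝ) (f : ℝ → ℝ → ℝ), SlowChannel a b qm qM c δ f → δ ≤ δ₀ →
      (∀ η, 0 < η → PeakBound a b (Bf η) η f) → ∀ e ∈ Ioo a b, ∀ e' ∈ Ioo a b,
        |e - e'| ≤ sigmaMax a b f → |natEntropy (f e) - natEntropy (f e')| ≤ ω := by
  set η := ω / 8 with hη
  have hη0 : 0 < η := by positivity
  set B := Bf η
  have hB : 3 ≤ B := hBf η hη0
  set ε := 1 - Real.exp (-(ω / 8)) with hε
  have hε0 : 0 < ε := sub_pos.2 (Real.exp_zero ▸ Real.exp_lt_exp.2 (by linarith))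
  have hε1 : ε < 1 := by linarith [Real.exp_pos (-(ω / 8))]
  have hlogε : Real.log (1 - ε) = -(ω / 8) := by rw [hε, sub_sub_cancel, Real.log_exp]
  set C := Real.log B + Real.log (2 / ε) with hC
  have hC0 : 0 ≤ C := add_nonneg (Real.log_nonneg (by linarith))
    (Real.log_nonneg (by rw [le_div_iff₀ hε0]; linarith))
  have hτ0 : 0 < ω / (8 * (C + 1)) := by positivity
  obtain ⟨δ₁, hδ₁, H⟩ := exists_shape_close c hc Bf hBf one_pos hτ0
  refine ⟨min δ₁ (ω / 4), by positivity, fun a b qm qM δ f h hδ hp => ?_⟩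
  have main : ∀ e ∈ Ioo a b, ∀ e' ∈ Ioo a b, |e - e'| ≤ sigmaMax a b f →
      natEntropy (f e') - natEntropy (f e) ≤ ω := by
    intro e he e' he' hee
    obtain ⟨t1, t2⟩ := H a b qm qM δ f h (hδ.trans (min_le_left _ _)) hp e he e' he'
      (by rwa [one_mul])
    have h1 := h.isChannel.natEntropy_shape_sub_le he (by linarith) (hp η hη0) he' hε0 hε1
    have h2 := (abs_le.1 (h.log_stdDev_sub_le he he')).1
    have h3 : δ / sigmaMax a b f * |e - e'| ≤ ω / 4 := by
      calc _ ≤ δ / sigmaMax a b f * sigmaMax a b f := by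
            gcongr; exact div_nonneg h.delta_nonneg h.sigmaMax_pos.le
        _ = δ := div_mul_cancel₀ _ h.sigmaMax_pos.ne'
        _ ≤ _ := hδ.trans (min_le_right _ _)
    have h4 : C * (∫ x, |shape f e x - shape f e' x|) ≤ C * (ω / (8 * (C + 1))) := by gcongr
    have h5 : C * (ω / (8 * (C + 1))) + ω / (8 * (C + 1)) = ω / 8 := by field_simp
    rw [h.isChannel.natEntropy_eq he, h.isChannel.natEntropy_eq he']
    rw [hlogε] at h1
    linarith
  intro e he e' he' hee
  have h1 := main e he e' he' hee
  have h2 := main e' he' e he (by rwa [abs_sub_comm])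
  exact abs_le.2 ⟨by linarith, by linarith⟩

/-- A function that changes by at most `ω` over steps of length `s` changes at most linearly over
longer distances. -/
theorem abs_sub_le_of_step {g : ℝ → ℝ} {a b s ω : ℝ} (hs : 0 < s) (hω : 0 ≤ ω)
    (H : ∀ e ∈ Ioo a b, ∀ e' ∈ Ioo a b, |e - e'| ≤ s → |g e - g e'| ≤ ω)
    {e e' : ℝ} (he : e ∈ Ioo a b) (he' : e' ∈ Ioo a b) :
    |g e - g e'| ≤ ω * (1 + |e - e'| / s) := by
  wlog hle : e ≤ e' generalizing e e'
  · rw [abs_sub_comm, abs_sub_comm e]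
    exact this he' he (le_of_not_ge hle)
  have key : ∀ n : ℕ, ∀ r ∈ Ioo a b, e ≤ r → r - e ≤ n * s → |g e - g r| ≤ n * ω := by
    intro n
    induction n with
    | zero =>
      intro r _ her hr
      have : r = e := by simp at hr; linarith
      simp [this]
    | succ n ih =>
      intro r hr her hrs
      push_cast at hrs ⊢
      have hmid : max e (r - s) ∈ Ioo a b :=
        ⟨he.1.trans_le (le_max_left _ _), max_lt he.2 (by linarith [hr.2])⟩
      have h1 := ih _ hmid (le_max_left _ _) (by
        rcases max_choice e (r - s) with h | h <;> rw [h]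
        · simp only [sub_self]; positivity
        · linarith)
      have h2 := H _ hmid r hr (by
        rw [abs_le]
        constructor
        · linarith [le_max_right e (r - s)]
        · linarith [max_le her (show r - s ≤ r by linarith)])
      calc |g e - g r| ≤ |g e - g (max e (r - s))| + |g (max e (r - s)) - g r| :=
            abs_sub_le _ _ _
        _ ≤ (n + 1) * ω := by linarith
  rw [abs_sub_comm e, abs_of_nonneg (sub_nonneg.2 hle)]
  refine (key ⌈(e' - e) / s⌉₊ e' he' hle ?_).trans ?_
  · rw [← div_le_iff₀ hs]; exact Nat.le_ceil _
  · have := Nat.ceil_lt_add_one (div_nonneg (sub_nonneg.2 hle) hs.le)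
    rw [mul_comm]
    gcongr
    linarith

/-! ### Measurability in the input -/

namespace IsChannel

variable {a b qm qM : ℝ} {f : ℝ → ℝ → ℝ} (hf : IsChannel a b qm qM f)
include hf

theorem measurable_natEntropy : Measurable (fun e => natEntropy (f e)) := by
  have h : StronglyMeasurable (fun z : ℝ × ℝ => f z.1 z.2 * Real.log (f z.1 z.2)) :=
    (hf.measurable.mul (Real.measurable_log.comp hf.measurable)).stronglyMeasurable
  exact (h.integral_prod_right' (ν := volume)).neg.measurable

theorem measurable_mean : Measurable (mean f) := by
  have h : StronglyMeasurable (fun z : ℝ × ℝ => z.2 * f z.1 z.2) :=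
    (measurable_snd.mul hf.measurable).stronglyMeasurable
  exact (h.integral_prod_right' (ν := volume)).measurable

theorem measurable_stdDev : Measurable (stdDev f) := by
  have h : StronglyMeasurable (fun z : ℝ × ℝ => (z.2 - mean f z.1) ^ 2 * f z.1 z.2) :=
    (((measurable_snd.sub (hf.measurable_mean.comp measurable_fst)).pow_const 2).mul
      hf.measurable).stronglyMeasurable
  exact (h.integral_prod_right' (ν := volume)).measurable.sqrt

end IsChannel

theorem SlowChannel.exists_abs_log_stdDev_le {a b qm qM c δ : ℝ} {f : ℝ → ℝ → ℝ}
    (h : SlowChannel a b qm qM c δ f) : ∃ C, ∀ e ∈ Ioo a b, |Real.log (stdDev f e)| ≤ C := by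
  refine ⟨|Real.log (stdDev f ((a + b) / 2))| + δ / sigmaMax a b f * (b - a), fun e he => ?_⟩
  have h1 := h.log_stdDev_sub_le he h.midpoint_mem
  have h2 : |e - (a + b) / 2| ≤ b - a := by
    rw [abs_le]; constructor <;> linarith [he.1, he.2]
  have h3 : δ / sigmaMax a b f * |e - (a + b) / 2| ≤ δ / sigmaMax a b f * (b - a) := by
    gcongr; exact div_nonneg h.delta_nonneg h.sigmaMax_pos.le
  have h4 := abs_sub_abs_le_abs_sub (Real.log (stdDev f e)) (Real.log (stdDev f ((a + b) / 2)))
  linarith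

theorem IsChannel.abs_natEntropy_sub_log_le {a b qm qM B : ℝ} {f : ℝ → ℝ → ℝ}
    (hf : IsChannel a b qm qM f) (hB : 3 ≤ B) (hp : PeakBound a b B 1 f) {e : ℝ}
    (he : e ∈ Ioo a b) : |natEntropy (f e) - Real.log (stdDev f e)| ≤ 2 + Real.log B := by
  have h1 := hf.natEntropy_shape_le he
  have h2 := hf.le_natEntropy_shape he (by linarith) hp
  have h3 : 0 ≤ Real.log B := Real.log_nonneg (by linarith)
  rw [hf.natEntropy_eq he, add_sub_cancel_left, abs_le]
  constructor <;> linarith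

theorem SlowChannel.exists_abs_natEntropy_le {a b qm qM c δ B : ℝ} {f : ℝ → ℝ → ℝ}
    (h : SlowChannel a b qm qM c δ f) (hB : 3 ≤ B) (hp : PeakBound a b B 1 f) :
    ∃ C, ∀ e ∈ Ioo a b, |natEntropy (f e)| ≤ C := by
  obtain ⟨C, hC⟩ := h.exists_abs_log_stdDev_le
  refine ⟨C + (2 + Real.log B), fun e he => ?_⟩
  have h1 := h.isChannel.abs_natEntropy_sub_log_le hB hp he
  have h2 := abs_sub_abs_le_abs_sub (natEntropy (f e)) (Real.log (stdDev f e))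
  linarith [hC e he]

/-! ### Expectations under the joint law of input and output -/

/-- The conditional expectations of `|Φ|` given the input exist and are bounded. -/
def HasBoundedMoment (eMin eMax : ℝ) (f : ℝ → ℝ → ℝ) (Φ : ℝ × ℝ → ℝ) : Prop :=
  Measurable Φ ∧ ∃ C, ∀ e ∈ Ioo eMin eMax,
    Integrable (fun q => f e q * Φ (e, q)) ∧ ∫ q, |f e q * Φ (e, q)| ≤ C

namespace HasBoundedMoment

variable {a b qm qM : ℝ} {f : ℝ → ℝ → ℝ} {Φ Φ' : ℝ × ℝ → ℝ}

theorem add (h : HasBoundedMoment a b f Φ) (h' : HasBoundedMoment a b f Φ') :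
    HasBoundedMoment a b f (fun z => Φ z + Φ' z) := by
  obtain ⟨hm, C, hC⟩ := h
  obtain ⟨hm', C', hC'⟩ := h'
  refine ⟨hm.add hm', C + C', fun e he => ?_⟩
  have i1 := (hC e he).1
  have i2 := (hC' e he).1
  have i : Integrable (fun q => f e q * (Φ (e, q) + Φ' (e, q))) := by
    simp only [mul_add]
    exact i1.add i2
  refine ⟨i, ?_⟩
  have := i.abs.hasIntegralValue.mono (i1.abs.hasIntegralValue.add i2.abs.hasIntegralValue)
    fun q => by rw [mul_add]; exact abs_add_le _ _
  linarith [(hC e he).2, (hC' e he).2]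

theorem indicator (hf : IsChannel a b qm qM f) (h : HasBoundedMoment a b f Φ)
    {A : Set (ℝ × ℝ)} (hA : MeasurableSet A) : HasBoundedMoment a b f (A.indicator Φ) := by
  obtain ⟨hm, C, hC⟩ := h
  refine ⟨hm.indicator hA, C, fun e he => ?_⟩
  have i1 := (hC e he).1
  have hle : ∀ q, |f e q * A.indicator Φ (e, q)| ≤ |f e q * Φ (e, q)| := fun q => by
    by_cases hq : (e, q) ∈ A
    · rw [indicator_of_mem hq]
    · rw [indicator_of_notMem hq, mul_zero, abs_zero]; exact abs_nonneg _
  have i : Integrable (fun q => f e q * A.indicator Φ (e, q)) :=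
    i1.mono ((hf.measurable_right e).mul
      ((hm.indicator hA).comp measurable_prodMk_left)).aestronglyMeasurable
      (Eventually.of_forall hle)
  exact ⟨i, (i.abs.hasIntegralValue.mono i1.abs.hasIntegralValue hle).trans (hC e he).2⟩

theorem of_bounded (hf : IsChannel a b qm qM f) (hm : Measurable Φ) {C : ℝ}
    (hC : ∀ e ∈ Ioo a b, ∀ q ∈ Ioo qm qM, |Φ (e, q)| ≤ C) : HasBoundedMoment a b f Φ := by
  refine ⟨hm, C, fun e he => ?_⟩
  have hle : ∀ q, |f e q * Φ (e, q)| ≤ f e q * C := fun q => by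
    by_cases hq : q ∈ Ioo qm qM
    · rw [abs_mul, abs_of_nonneg (hf.nonneg e he q)]
      exact mul_le_mul_of_nonneg_left (hC e he q hq) (hf.nonneg e he q)
    · simp [hf.eq_zero e he q hq]
  have i : Integrable (fun q => f e q * Φ (e, q)) :=
    ((hf.integrable he).mul_const C).mono' ((hf.measurable_right e).mul
      (hm.comp measurable_prodMk_left)).aestronglyMeasurable (Eventually.of_forall hle)
  refine ⟨i, ?_⟩
  have := i.abs.hasIntegralValue.mono
    (HasIntegralValue.mul_const ⟨hf.integrable he, hf.integral_eq_one e he⟩ C) hle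
  linarith

theorem log_density (hf : IsChannel a b qm qM f) {C : ℝ}
    (hC : ∀ e ∈ Ioo a b, |natEntropy (f e)| ≤ C) :
    HasBoundedMoment a b f (fun z => Real.log (f z.1 z.2)) := by
  refine ⟨Real.measurable_log.comp hf.measurable, C + 2 * volume.real (Ioo qm qM),
    fun e he => ⟨hf.integrable_mul_log he, ?_⟩⟩
  have hc : Integrable ((Ioo qm qM).indicator fun _ : ℝ => (2 : ℝ)) :=
    (integrable_indicator_iff measurableSet_Ioo).2 (integrableOn_const (by simp))
  have := (hf.integrable_mul_log he).abs.hasIntegralValue.mono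
    ((hf.integrable_mul_log he).hasIntegralValue.add hc.hasIntegralValue) fun q => by
      by_cases hq : q ∈ Ioo qm qM
      · rw [indicator_of_mem hq]
        have h1 := mul_log_le_mul_log_add (hf.nonneg e he q) one_pos
        rw [Real.log_one, mul_zero] at h1
        have h2 := hf.nonneg e he q
        exact abs_le.2 ⟨by linarith, by linarith⟩
      · rw [indicator_of_notMem hq, hf.eq_zero e he q hq]; simp
  rw [integral_indicator measurableSet_Ioo, setIntegral_const, smul_eq_mul] at this
  have h3 := (abs_le.1 (hC e he)).1
  rw [natEntropy] at h3
  linarith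

end HasBoundedMoment

section Joint

variable {a b qm qM : ℝ} {f : ℝ → ℝ → ℝ} {p : ℝ → ℝ} {Φ : ℝ × ℝ → ℝ}

theorem IsInputDensity.integrable (hp : IsInputDensity a b p) : Integrable p :=
  .of_integral_ne_zero (by rw [hp.integral_eq_one]; exact one_ne_zero)

theorem joint_nonneg (hf : IsChannel a b qm qM f) (hp : IsInputDensity a b p) (e q : ℝ) :
    0 ≤ f e q * p e := by
  by_cases he : e ∈ Ioo a b
  · exact mul_nonneg (hf.nonneg e he q) (hp.nonneg e)
  · simp [hp.eq_zero e he]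

theorem HasBoundedMoment.integrable_joint (hf : IsChannel a b qm qM f)
    (hp : IsInputDensity a b p) (h : HasBoundedMoment a b f Φ) :
    Integrable (fun z : ℝ × ℝ => f z.1 z.2 * p z.1 * Φ z) (volume.prod volume) := by
  obtain ⟨hm, C, hC⟩ := h
  have hmeas : AEStronglyMeasurable (fun z : ℝ × ℝ => f z.1 z.2 * p z.1 * Φ z)
      (volume.prod volume) :=
    ((hf.measurable.mul (hp.measurable.comp measurable_fst)).mul hm).aestronglyMeasurable
  rw [integrable_prod_iff hmeas]
  refine ⟨Eventually.of_forall fun e => ?_, ?_⟩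
  · by_cases he : e ∈ Ioo a b
    · refine ((hC e he).1.const_mul (p e)).congr (Eventually.of_forall fun q => ?_)
      simp only; ring
    · simp [hp.eq_zero e he]
  · refine (hp.integrable.const_mul C).mono' hmeas.norm.integral_prod_right'
      (Eventually.of_forall fun e => ?_)
    rw [Real.norm_of_nonneg (integral_nonneg fun q => norm_nonneg _)]
    by_cases he : e ∈ Ioo a b
    · have : ∀ q, ‖f e q * p e * Φ (e, q)‖ = |f e q * Φ (e, q)| * p e := fun q => by
        rw [Real.norm_eq_abs, mul_right_comm, abs_mul, abs_of_nonneg (hp.nonneg e)]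
      simp only [this]
      rw [integral_mul_const]
      exact mul_le_mul_of_nonneg_right (hC e he).2 (hp.nonneg e)
    · simp [hp.eq_zero e he]

theorem HasBoundedMoment.integral_joint (hf : IsChannel a b qm qM f)
    (hp : IsInputDensity a b p) (h : HasBoundedMoment a b f Φ) :
    ∫ q, ∫ e, f e q * p e * Φ (e, q) = ∫ e, (∫ q, f e q * Φ (e, q)) * p e := by
  have hi := h.integrable_joint hf hp
  rw [← integral_prod_symm _ hi, integral_prod _ hi]
  refine integral_congr_ae (Eventually.of_forall fun e => ?_)
  simp only
  rw [← integral_mul_const]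
  congr 1; ext q; ring

theorem HasBoundedMoment.one (hf : IsChannel a b qm qM f) :
    HasBoundedMoment a b f (fun _ => 1) :=
  .of_bounded hf measurable_const (C := 1) (by simp)

theorem integrable_joint (hf : IsChannel a b qm qM f) (hp : IsInputDensity a b p) :
    Integrable (fun z : ℝ × ℝ => f z.1 z.2 * p z.1) (volume.prod volume) := by
  simpa using (HasBoundedMoment.one hf).integrable_joint hf hp

theorem outputDensity_nonneg (hf : IsChannel a b qm qM f) (hp : IsInputDensity a b p) (q : ℝ) :
    0 ≤ outputDensity f p q :=
  integral_nonneg fun e => joint_nonneg hf hp e q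

theorem outputDensity_eq_zero (hf : IsChannel a b qm qM f) (hp : IsInputDensity a b p) {q : ℝ}
    (hq : q ∉ Ioo qm qM) : outputDensity f p q = 0 := by
  rw [outputDensity]
  convert integral_zero ℝ ℝ with e
  by_cases he : e ∈ Ioo a b
  · simp [hf.eq_zero e he q hq]
  · simp [hp.eq_zero e he]

theorem hasIntegralValue_outputDensity (hf : IsChannel a b qm qM f) (hp : IsInputDensity a b p) :
    HasIntegralValue (outputDensity f p) 1 := by
  refine ⟨(integrable_joint hf hp).integral_prod_right, ?_⟩
  have h := (HasBoundedMoment.one hf).integral_joint hf hp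
  simp only [mul_one] at h
  rw [show ∫ q, outputDensity f p q = _ from h, ← hp.integral_eq_one]
  refine integral_congr_ae (Eventually.of_forall fun e => ?_)
  by_cases he : e ∈ Ioo a b
  · simp [hf.integral_eq_one e he]
  · simp [hp.eq_zero e he]

theorem integrable_natEntropy_mul (hf : IsChannel a b qm qM f) (hp : IsInputDensity a b p) {C : ℝ}
    (hC : ∀ e ∈ Ioo a b, |natEntropy (f e)| ≤ C) :
    Integrable (fun e => natEntropy (f e) * p e) := by
  refine (hp.integrable.const_mul C).mono'
    (hf.measurable_natEntropy.mul hp.measurable).aestronglyMeasurable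
    (Eventually.of_forall fun e => ?_)
  by_cases he : e ∈ Ioo a b
  · rw [Real.norm_eq_abs, abs_mul, abs_of_nonneg (hp.nonneg e)]
    exact mul_le_mul_of_nonneg_right (hC e he) (hp.nonneg e)
  · simp [hp.eq_zero e he]

/-- The variational bound for mutual information: any sub-probability kernel `lam` from outputs to
inputs may be used in place of the posterior density. Here it appears as an upper bound for the
integrand of the (negative) output entropy. -/
theorem outputDensity_mul_log_le (hf : IsChannel a b qm qM f) (hp : IsInputDensity a b p)
    (hΦ : HasBoundedMoment a b f Φ) {lam : ℝ → ℝ → ℝ} (hlam0 : ∀ e q, 0 ≤ lam e q)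
    (hlam : ∀ q, Integrable (fun e => lam e q)) (hlam1 : ∀ q, ∫ e, lam e q ≤ 1)
    (H : ∀ e ∈ Ioo a b, ∀ q, 0 < f e q * p e →
      0 < lam e q ∧ Real.log (f e q * p e) - Real.log (lam e q) ≤ Φ (e, q)) :
    ∀ᵐ q, outputDensity f p q * Real.log (outputDensity f p q) ≤
      ∫ e, f e q * p e * Φ (e, q) := by
  filter_upwards [(integrable_joint hf hp).prod_left_ae,
    (hΦ.integrable_joint hf hp).prod_left_ae] with q hJ hJΦ
  rcases (outputDensity_nonneg hf hp q).eq_or_lt with h0 | h0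
  · have hz := (integral_eq_zero_iff_of_nonneg (fun e => joint_nonneg hf hp e q) hJ).1 h0.symm
    rw [← h0, zero_mul]
    refine (integral_eq_zero_of_ae ?_).ge
    filter_upwards [hz] with e he
    simp only [Pi.zero_apply] at he
    simp [he]
  · set t := outputDensity f p q with ht
    have hJt : HasIntegralValue (fun e => f e q * p e) t := ⟨hJ, rfl⟩
    have h := (hJt.mul_const (Real.log t)).mono
      ((hJΦ.hasIntegralValue.add ((hlam q).hasIntegralValue.const_mul t)).sub hJt) fun e => by
        rcases (joint_nonneg hf hp e q).eq_or_lt with h1 | h1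
        · rw [← h1]
          have := mul_nonneg h0.le (hlam0 e q)
          linarith
        · have he : e ∈ Ioo a b := by
            by_contra he
            simp [hp.eq_zero e he] at h1
          obtain ⟨hl, hle⟩ := H e he q h1
          have h2 := mul_log_le_mul_log_add h1.le (mul_pos h0 hl)
          rw [Real.log_mul h0.ne' hl.ne'] at h2
          have h3 := mul_le_mul_of_nonneg_left hle h1.le
          linarith
    have := mul_le_mul_of_nonneg_left (hlam1 q) h0.le
    linarith

/-- The entropy integral of the output converges for every input density. -/
theorem integrable_outputDensity_mul_log (hf : IsChannel a b qm qM f) (hp : IsInputDensity a b p)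
    {C : ℝ} (hC : ∀ e ∈ Ioo a b, |natEntropy (f e)| ≤ C) :
    Integrable (fun q => outputDensity f p q * Real.log (outputDensity f p q)) := by
  have hΦ := HasBoundedMoment.log_density hf hC
  -- the kernel that ignores the output and returns the input density gives Jensen's inequality
  have hle := outputDensity_mul_log_le hf hp hΦ (lam := fun e _ => p e) (fun e _ => hp.nonneg e)
    (fun _ => hp.integrable) (fun _ => hp.integral_eq_one.le) fun e he q h => by
      have hpe : 0 < p e := (hp.nonneg e).lt_of_ne fun h0 => by simp [← h0] at h
      have hfe : f e q ≠ 0 := fun h0 => by simp [h0] at h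
      refine ⟨hpe, ?_⟩
      rw [Real.log_mul hfe hpe.ne', add_sub_cancel_right]
  have hc : Integrable ((Ioo qm qM).indicator fun _ : ℝ => (1 : ℝ)) :=
    (integrable_indicator_iff measurableSet_Ioo).2 (integrableOn_const (by simp))
  have hu := (hΦ.integrable_joint hf hp).integral_prod_right
  have hm := (hasIntegralValue_outputDensity hf hp).1.aestronglyMeasurable.aemeasurable
  refine (hu.abs.add hc).mono' (hm.mul hm.log).aestronglyMeasurable ?_
  filter_upwards [hle] with q hq
  simp only [Pi.add_apply]
  by_cases hqI : q ∈ Ioo qm qM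
  · rw [indicator_of_mem hqI, Real.norm_eq_abs]
    have h1 := mul_log_le_mul_log_add (outputDensity_nonneg hf hp q) one_pos
    rw [Real.log_one, mul_zero] at h1
    have h2 := outputDensity_nonneg hf hp q
    have h3 := le_abs_self (∫ e, f e q * p e * Real.log (f e q))
    have h4 := abs_nonneg (∫ e, f e q * p e * Real.log (f e q))
    exact abs_le.2 ⟨by linarith, by linarith⟩
  · rw [outputDensity_eq_zero hf hp hqI, indicator_of_notMem hqI]
    simp

theorem neg_natEntropy_outputDensity_le (hf : IsChannel a b qm qM f) (hp : IsInputDensity a b p)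
    {C : ℝ} (hC : ∀ e ∈ Ioo a b, |natEntropy (f e)| ≤ C)
    (hΦ : HasBoundedMoment a b f Φ) {lam : ℝ → ℝ → ℝ} (hlam0 : ∀ e q, 0 ≤ lam e q)
    (hlam : ∀ q, Integrable (fun e => lam e q)) (hlam1 : ∀ q, ∫ e, lam e q ≤ 1)
    (H : ∀ e ∈ Ioo a b, ∀ q, 0 < f e q * p e →
      0 < lam e q ∧ Real.log (f e q * p e) - Real.log (lam e q) ≤ Φ (e, q)) :
    -natEntropy (outputDensity f p) ≤ ∫ e, (∫ q, f e q * Φ (e, q)) * p e := by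
  rw [natEntropy, neg_neg, ← hΦ.integral_joint hf hp]
  exact integral_mono_ae (integrable_outputDensity_mul_log hf hp hC)
    (hΦ.integrable_joint hf hp).integral_prod_right
    (outputDensity_mul_log_le hf hp hΦ hlam0 hlam hlam1 H)

/-- A crude bound, which shows that the mutual information is bounded over all input densities. -/
theorem natEntropy_outputDensity_le_length (hf : IsChannel a b qm qM f)
    (hp : IsInputDensity a b p) {C : ℝ} (hC : ∀ e ∈ Ioo a b, |natEntropy (f e)| ≤ C) :
    natEntropy (outputDensity f p) ≤ volume.real (Ioo qm qM) := by
  have hc : Integrable ((Ioo qm qM).indicator fun _ : ℝ => (1 : ℝ)) :=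
    (integrable_indicator_iff measurableSet_Ioo).2 (integrableOn_const (by simp))
  have h := ((hasIntegralValue_outputDensity hf hp).sub hc.hasIntegralValue).mono
    (integrable_outputDensity_mul_log hf hp hC).hasIntegralValue fun q => by
      by_cases hqI : q ∈ Ioo qm qM
      · rw [indicator_of_mem hqI]
        have h1 := mul_log_le_mul_log_add (outputDensity_nonneg hf hp q) one_pos
        rw [Real.log_one, mul_zero] at h1
        linarith
      · rw [outputDensity_eq_zero hf hp hqI, indicator_of_notMem hqI]
        simp
  rw [integral_indicator measurableSet_Ioo, setIntegral_const, smul_eq_mul] at h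
  rw [natEntropy]
  linarith

/-- Gibbs' inequality for the output: the reference density is `exp G`, up to normalisation. -/
theorem natEntropy_outputDensity_le (hf : IsChannel a b qm qM f) (hp : IsInputDensity a b p)
    {C : ℝ} (hC : ∀ e ∈ Ioo a b, |natEntropy (f e)| ≤ C) {G : ℝ → ℝ}
    (hG : HasBoundedMoment a b f fun z => G z.2) (hGi : Integrable fun q => Real.exp (G q)) {W : ℝ}
    (hW : 0 < W) (hGW : ∫ q, Real.exp (G q) ≤ W) :
    natEntropy (outputDensity f p) ≤ Real.log W - ∫ e, (∫ q, f e q * G q) * p e := by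
  have h1 := hasIntegralValue_outputDensity hf hp
  have h2 : HasIntegralValue (fun q => outputDensity f p q * G q)
      (∫ e, (∫ q, f e q * G q) * p e) := by
    have hi := (hG.integrable_joint hf hp).integral_prod_right
    have hv := hG.integral_joint hf hp
    simp only [integral_mul_const] at hi hv
    exact ⟨hi, hv⟩
  have h := (((h2.sub (h1.mul_const (Real.log W))).add h1).sub
    (hGi.hasIntegralValue.mul_const W⁻¹)).mono
    (integrable_outputDensity_mul_log hf hp hC).hasIntegralValue fun q => by
      have := mul_log_le_mul_log_add (outputDensity_nonneg hf hp q)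
        (mul_pos (Real.exp_pos (G q)) (inv_pos.2 hW))
      rw [Real.log_mul (Real.exp_pos _).ne' (inv_pos.2 hW).ne', Real.log_exp, Real.log_inv] at this
      linarith
  have h3 : (∫ q, Real.exp (G q)) * W⁻¹ ≤ 1 := by
    rw [← div_eq_mul_inv, div_le_one hW]; exact hGW
  rw [natEntropy]
  linarith

end Joint

/-! ### The entropy envelope -/

/-- The largest `k`-Lipschitz function `H` of the output with `H (m(e)) ≤ h(Q|e)` (in nats) for all
inputs `e`. The function `exp (-H)`, normalised, is the reference output density. -/
noncomputable def envelope (eMin eMax k : ℝ) (f : ℝ → ℝ → ℝ) (q : ℝ) : ℝ :=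
  ⨅ e : Ioo eMin eMax, (natEntropy (f e) + k * |q - mean f e|)

section Envelope

variable {a b k C : ℝ} {f : ℝ → ℝ → ℝ}

theorem envelope_le (hk : 0 ≤ k) (hC : ∀ e ∈ Ioo a b, |natEntropy (f e)| ≤ C) {e : ℝ}
    (he : e ∈ Ioo a b) (q : ℝ) : envelope a b k f q ≤ natEntropy (f e) + k * |q - mean f e| := by
  refine ciInf_le (f := fun e : Ioo a b => natEntropy (f e) + k * |q - mean f e|) ⟨-C, ?_⟩ ⟨e, he⟩
  rintro _ ⟨r, rfl⟩
  have := (abs_le.1 (hC r r.2)).1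
  have : 0 ≤ k * |q - mean f r| := by positivity
  simp only
  linarith

theorem le_envelope (hab : a < b) {q x : ℝ}
    (h : ∀ e ∈ Ioo a b, x ≤ natEntropy (f e) + k * |q - mean f e|) : x ≤ envelope a b k f q := by
  have : Nonempty (Ioo a b) := (nonempty_Ioo.2 hab).to_subtype
  exact le_ciInf fun e => h e e.2

theorem envelope_sub_le (hab : a < b) (hk : 0 ≤ k) (hC : ∀ e ∈ Ioo a b, |natEntropy (f e)| ≤ C)
    (q q' : ℝ) : envelope a b k f q ≤ envelope a b k f q' + k * |q - q'| := by
  rw [← sub_le_iff_le_add]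
  refine le_envelope hab fun e he => ?_
  have h1 := envelope_le hk hC he q
  have h2 := mul_le_mul_of_nonneg_left (abs_sub_le q q' (mean f e)) hk
  linarith

theorem continuous_envelope (hab : a < b) (hk : 0 ≤ k)
    (hC : ∀ e ∈ Ioo a b, |natEntropy (f e)| ≤ C) : Continuous (envelope a b k f) := by
  refine (LipschitzWith.of_le_add_mul ⟨k, hk⟩ fun q q' => ?_).continuous
  rw [Real.dist_eq]
  exact envelope_sub_le hab hk hC q q'

theorem HasBoundedMoment.comp_snd {qm qM : ℝ} (hf : IsChannel a b qm qM f) {G : ℝ → ℝ}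
    (hG : Continuous G) : HasBoundedMoment a b f fun z => G z.2 := by
  obtain ⟨D, hD⟩ := isCompact_Icc.exists_bound_of_continuousOn (s := Icc qm qM) hG.continuousOn
  exact .of_bounded hf (hG.measurable.comp measurable_snd)
    fun e _ q hq => hD q (Ioo_subset_Icc_self hq)

end Envelope

namespace SlowChannel

variable {a b qm qM c δ : ℝ} {f : ℝ → ℝ → ℝ} (h : SlowChannel a b qm qM c δ f)
include h

/-- If the conditional entropy changes slowly, then the envelope is close to it. -/
theorem le_envelope {k ω : ℝ} (hω : 0 ≤ ω)
    (hL : ∀ e ∈ Ioo a b, ∀ e' ∈ Ioo a b,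
      |natEntropy (f e) - natEntropy (f e')| ≤ ω * (1 + |e - e'| / sigmaMax a b f))
    (hk : ω ≤ k * sigmaMax a b f * c) {e : ℝ} (he : e ∈ Ioo a b) (q : ℝ) :
    natEntropy (f e) - ω - k * |q - mean f e| ≤ envelope a b k f q := by
  have hσ := h.sigmaMax_pos
  have hc := h.slope_pos
  have hk0 : 0 ≤ k := by
    by_contra hneg
    have : k * sigmaMax a b f * c < 0 :=
      mul_neg_of_neg_of_pos (mul_neg_of_neg_of_pos (not_le.1 hneg) hσ) hc
    linarith
  refine SlowChange.le_envelope h.lt fun e' he' => ?_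
  have h1 := (abs_le.1 (hL e he e' he')).2
  have h2 : ω * (|e - e'| / sigmaMax a b f) ≤ k * |mean f e - mean f e'| := by
    calc ω * (|e - e'| / sigmaMax a b f)
        ≤ k * sigmaMax a b f * c * (|e - e'| / sigmaMax a b f) := by gcongr
      _ = k * (c * |e - e'|) := by field_simp
      _ ≤ _ := mul_le_mul_of_nonneg_left (h.mul_abs_sub_le he he') hk0
  have h3 := mul_le_mul_of_nonneg_left (abs_sub_le (mean f e) q (mean f e')) hk0
  rw [abs_sub_comm (mean f e) q] at h3
  linarith

/-! ### The normalising constant -/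

theorem measurableSet_image_mean : MeasurableSet (mean f '' Ioo a b) := by
  have hc : ContinuousOn (mean f) (Ioo a b) := fun r hr =>
    (h.slow.mean_differentiable r hr).continuousAt.continuousWithinAt
  exact (isPreconnected_Ioo.image _ hc).ordConnected.measurableSet

theorem image_mean_subset : mean f '' Ioo a b ⊆ Ioo qm qM := by
  rintro _ ⟨e, he, rfl⟩
  exact h.isChannel.mean_mem he

theorem hasDerivWithinAt_mean : ∀ e ∈ Ioo a b,
    HasDerivWithinAt (mean f) (deriv (mean f) e) (Ioo a b) e := fun e he =>
  (h.slow.mean_differentiable e he).hasDerivAt.hasDerivWithinAt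

theorem deriv_mean_pos {e : ℝ} (he : e ∈ Ioo a b) : 0 < deriv (mean f) e :=
  h.slope_pos.trans_le (h.le_slope e he)

theorem integrableOn_deriv_mean : IntegrableOn (deriv (mean f)) (Ioo a b) := by
  have h1 : IntegrableOn (fun _ : ℝ => (1 : ℝ)) (mean f '' Ioo a b) :=
    integrableOn_const (((measure_mono h.image_mean_subset).trans_lt (by simp)).ne)
  rw [integrableOn_image_iff_integrableOn_abs_deriv_smul measurableSet_Ioo
    h.hasDerivWithinAt_mean h.strictMonoOn_mean.injOn] at h1
  refine h1.congr_fun (fun e he => ?_) measurableSet_Ioo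
  simp [abs_of_pos (h.deriv_mean_pos he)]

theorem integrableOn_deriv_mean_mul_exp {C : ℝ} (hC : ∀ e ∈ Ioo a b, |natEntropy (f e)| ≤ C) :
    IntegrableOn (fun e => deriv (mean f) e * Real.exp (-natEntropy (f e))) (Ioo a b) := by
  refine Integrable.mono' (h.integrableOn_deriv_mean.mul_const (Real.exp C))
    ((measurable_deriv _).mul h.isChannel.measurable_natEntropy.neg.exp).aestronglyMeasurable ?_
  filter_upwards [ae_restrict_mem measurableSet_Ioo] with e he
  have h0 := h.deriv_mean_pos he
  rw [Real.norm_of_nonneg (by positivity)]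
  gcongr
  linarith [(abs_le.1 (hC e he)).1]

theorem normConst_eq :
    normConst a b f = ∫ e in Ioo a b, deriv (mean f) e * Real.exp (-natEntropy (f e)) := by
  rw [normConst, intervalIntegral.integral_of_le h.lt.le, integral_Ioc_eq_integral_Ioo]
  simp only [two_rpow_entropy, Real.exp_neg, div_eq_mul_inv]

/-- A lower bound for the normalising constant from one subinterval of inputs. -/
theorem le_normConst {C : ℝ} (hC : ∀ e ∈ Ioo a b, |natEntropy (f e)| ≤ C) {r s x : ℝ}
    (hrs : r ≤ s) (hsub : Ioo r s ⊆ Ioo a b) (hx : ∀ e ∈ Ioo r s, natEntropy (f e) ≤ x) :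
    (s - r) * (c * Real.exp (-x)) ≤ normConst a b f := by
  have hi := h.integrableOn_deriv_mean_mul_exp hC
  rw [h.normConst_eq]
  calc (s - r) * (c * Real.exp (-x)) = ∫ _ in Ioo r s, c * Real.exp (-x) := by
        rw [setIntegral_const, Real.volume_real_Ioo_of_le hrs, smul_eq_mul]
    _ ≤ ∫ e in Ioo r s, deriv (mean f) e * Real.exp (-natEntropy (f e)) := by
        refine setIntegral_mono_on (integrableOn_const (by simp)) (hi.mono_set hsub)
          measurableSet_Ioo fun e he => ?_
        have h1 := h.le_slope e (hsub he)
        have h2 := hx e he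
        have h3 := h.deriv_mean_pos (hsub he)
        gcongr
    _ ≤ _ := by
        refine setIntegral_mono_set hi ?_ hsub.eventuallyLE
        filter_upwards [ae_restrict_mem measurableSet_Ioo] with e he
        have := h.deriv_mean_pos he
        simp only [Pi.zero_apply]
        positivity

theorem normConst_pos {C : ℝ} (hC : ∀ e ∈ Ioo a b, |natEntropy (f e)| ≤ C) :
    0 < normConst a b f := by
  refine lt_of_lt_of_le ?_ (h.le_normConst hC h.lt.le Subset.rfl
    fun e he => (abs_le.1 (hC e he)).2)
  have h1 := sub_pos.2 h.lt
  have h2 := h.slope_pos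
  positivity

/-- No single input carries much of the normalising constant. -/
theorem exp_neg_natEntropy_le {C : ℝ} (hC : ∀ e ∈ Ioo a b, |natEntropy (f e)| ≤ C) {ω K : ℝ}
    (hω : 0 ≤ ω) (hK : 0 < K) (hKσ : 2 * (K * sigmaMax a b f) ≤ b - a)
    (hL : ∀ e ∈ Ioo a b, ∀ e' ∈ Ioo a b,
      |natEntropy (f e) - natEntropy (f e')| ≤ ω * (1 + |e - e'| / sigmaMax a b f))
    {e : ℝ} (he : e ∈ Ioo a b) :
    Real.exp (-natEntropy (f e)) ≤
      normConst a b f * Real.exp (ω * (1 + K)) / (c * K * sigmaMax a b f) := by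
  have hσ := h.sigmaMax_pos
  have hc := h.slope_pos
  have hKs : 0 < K * sigmaMax a b f := by positivity
  have key : ∀ e' ∈ Ioo a b, |e - e'| ≤ K * sigmaMax a b f →
      natEntropy (f e') ≤ natEntropy (f e) + ω * (1 + K) := fun e' he' hd => by
    have h1 := (abs_le.1 (hL e he e' he')).1
    have h2 : |e - e'| / sigmaMax a b f ≤ K := by rwa [div_le_iff₀ hσ]
    have h3 : ω * (1 + |e - e'| / sigmaMax a b f) ≤ ω * (1 + K) := by gcongr
    linarith
  have main : K * sigmaMax a b f * (c * Real.exp (-(natEntropy (f e) + ω * (1 + K)))) ≤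
      normConst a b f := by
    rcases le_total e ((a + b) / 2) with hm | hm
    · have hsub : Ioo e (e + K * sigmaMax a b f) ⊆ Ioo a b :=
        Ioo_subset_Ioo he.1.le (by linarith)
      have := h.le_normConst hC (by linarith) hsub fun r hr => key r (hsub hr)
        (abs_le.2 ⟨by linarith [hr.2], by linarith [hr.1]⟩)
      simpa using this
    · have hsub : Ioo (e - K * sigmaMax a b f) e ⊆ Ioo a b :=
        Ioo_subset_Ioo (by linarith) he.2.le
      have := h.le_normConst hC (by linarith) hsub fun r hr => key r (hsub hr)
        (abs_le.2 ⟨by linarith [hr.2], by linarith [hr.1]⟩)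
      simpa using this
  rw [le_div_iff₀ (by positivity)]
  rw [neg_add, Real.exp_add] at main
  calc Real.exp (-natEntropy (f e)) * (c * K * sigmaMax a b f)
      = K * sigmaMax a b f * (c * (Real.exp (-natEntropy (f e)) * Real.exp (-(ω * (1 + K))))) *
        Real.exp (ω * (1 + K)) := by
        rw [Real.exp_neg (ω * (1 + K))]; field_simp
    _ ≤ _ := by gcongr

/-! ### The upper bound -/

/-- The reference density `exp (-H)` has total mass close to the normalising constant: over the
range of the mean this is the substitution `q = m(e)`, and outside it there are two exponential
tails. -/
theorem integral_exp_neg_envelope {C : ℝ} (hC : ∀ e ∈ Ioo a b, |natEntropy (f e)| ≤ C) {k ω S : ℝ}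
    (hk : 0 < k) (henv : ∀ e ∈ Ioo a b, natEntropy (f e) - ω ≤ envelope a b k f (mean f e))
    (hS : ∀ e ∈ Ioo a b, Real.exp (-natEntropy (f e)) ≤ S) :
    Integrable (fun q => Real.exp (-envelope a b k f q)) ∧
      ∫ q, Real.exp (-envelope a b k f q) ≤ Real.exp ω * normConst a b f + 4 * S / k := by
  set A := mean f '' Ioo a b with hA
  have hAm : MeasurableSet A := h.measurableSet_image_mean
  have hcont : Continuous (fun q => Real.exp (-envelope a b k f q)) :=
    (continuous_envelope h.lt hk.le hC).neg.rexp
  have hiA : IntegrableOn (fun q => Real.exp (-envelope a b k f q)) A :=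
    (hcont.integrableOn_Icc (a := qm) (b := qM)).mono_set
      (h.image_mean_subset.trans Ioo_subset_Icc_self)
  have hSpos : 0 < S := (Real.exp_pos _).trans_le (hS _ h.midpoint_mem)
  have hord : A.OrdConnected := (isPreconnected_Ioo.image _ fun r hr =>
    (h.slow.mean_differentiable r hr).continuousAt.continuousWithinAt).ordConnected
  have hbA : BddAbove A := ⟨qM, fun x hx => (h.image_mean_subset hx).2.le⟩
  have hbB : BddBelow A := ⟨qm, fun x hx => (h.image_mean_subset hx).1.le⟩
  have hAne : A.Nonempty := ⟨_, mem_image_of_mem _ h.midpoint_mem⟩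
  have hlap : ∀ y : ℝ, HasIntegralValue (fun q => S * Real.exp (-k * |q - y|)) (S * (2 / k)) :=
    fun y => HasIntegralValue.const_mul
      ⟨(integrable_exp_neg_mul_abs hk).comp_sub_right y, by
        rw [integral_sub_right_eq_self (fun q => Real.exp (-k * |q|)) y,
          integral_exp_neg_mul_abs hk]⟩ S
  have htail : ∀ q y : ℝ, (∀ e ∈ Ioo a b, |q - y| ≤ |q - mean f e|) →
      Real.exp (-envelope a b k f q) ≤ S * Real.exp (-k * |q - y|) := fun q y hy => by
    rw [← Real.exp_log hSpos, ← Real.exp_add, Real.exp_le_exp]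
    have := SlowChange.le_envelope (f := f) (k := k) (q := q) (x := -Real.log S + k * |q - y|) h.lt
      fun e he => by
        have h1 := mul_le_mul_of_nonneg_left (hy e he) hk.le
        have h2 := (Real.le_log_iff_exp_le hSpos).2 (hS e he)
        linarith
    linarith
  have hle : ∀ q, Real.exp (-envelope a b k f q) ≤
      A.indicator (fun q => Real.exp (-envelope a b k f q)) q +
        (S * Real.exp (-k * |q - sInf A|) + S * Real.exp (-k * |q - sSup A|)) := fun q => by
    have p1 : 0 < S * Real.exp (-k * |q - sInf A|) := by positivity
    have p2 : 0 < S * Real.exp (-k * |q - sSup A|) := by positivity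
    by_cases hq : q ∈ A
    · rw [indicator_of_mem hq]; linarith
    rw [indicator_of_notMem hq, zero_add]
    by_cases hlow : ∃ x ∈ A, x < q
    · obtain ⟨x, hxA, hxq⟩ := hlow
      have hup : ∀ y ∈ A, y ≤ q := fun y hy => by
        by_contra hyq
        exact hq (hord.out hxA hy ⟨hxq.le, (not_le.1 hyq).le⟩)
      have := htail q (sSup A) fun e he => by
        have h1 := le_csSup hbA (mem_image_of_mem (mean f) he)
        have h2 := csSup_le hAne hup
        rw [abs_of_nonneg (by linarith), abs_of_nonneg (by linarith)]
        linarith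
      linarith
    · have hup : ∀ y ∈ A, q ≤ y := fun y hy => by
        by_contra hyq
        exact hlow ⟨y, hy, not_le.1 hyq⟩
      have := htail q (sInf A) fun e he => by
        have h1 := csInf_le hbB (mem_image_of_mem (mean f) he)
        have h2 := le_csInf hAne hup
        rw [abs_of_nonpos (by linarith), abs_of_nonpos (by linarith)]
        linarith
      linarith
  have hI := ((hiA.integrable_indicator hAm).hasIntegralValue.add ((hlap (sInf A)).add
    (hlap (sSup A))))
  have hint : Integrable (fun q => Real.exp (-envelope a b k f q)) :=
    hI.1.mono' hcont.aestronglyMeasurable (Eventually.of_forall fun q => by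
      rw [Real.norm_of_nonneg (Real.exp_pos _).le]; exact hle q)
  refine ⟨hint, (hint.hasIntegralValue.mono hI hle).trans ?_⟩
  have hmid : ∫ q, A.indicator (fun q => Real.exp (-envelope a b k f q)) q ≤
      Real.exp ω * normConst a b f := by
    rw [integral_indicator hAm, hA, integral_image_eq_integral_abs_deriv_smul measurableSet_Ioo
      h.hasDerivWithinAt_mean h.strictMonoOn_mean.injOn, h.normConst_eq, ← integral_const_mul]
    have hi := h.integrableOn_deriv_mean_mul_exp hC
    refine setIntegral_mono_on ((integrableOn_image_iff_integrableOn_abs_deriv_smul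
      measurableSet_Ioo h.hasDerivWithinAt_mean h.strictMonoOn_mean.injOn _).1 hiA)
      (hi.const_mul _) measurableSet_Ioo fun e he => ?_
    have h0 := h.deriv_mean_pos he
    rw [abs_of_pos h0, smul_eq_mul]
    have : Real.exp (-envelope a b k f (mean f e)) ≤
        Real.exp ω * Real.exp (-natEntropy (f e)) := by
      rw [← Real.exp_add, Real.exp_le_exp]; linarith [henv e he]
    calc _ ≤ deriv (mean f) e * (Real.exp ω * Real.exp (-natEntropy (f e))) := by gcongr
      _ = _ := by ring
  have : S * (2 / k) + S * (2 / k) = 4 * S / k := by ring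
  linarith

/-- The envelope costs at most `k σ_max` more than the conditional entropy, since the mean absolute
deviation is at most the standard deviation. -/
theorem integral_mul_envelope_le {C : ℝ} (hC : ∀ e ∈ Ioo a b, |natEntropy (f e)| ≤ C) {k : ℝ}
    (hk : 0 ≤ k) {e : ℝ} (he : e ∈ Ioo a b) :
    ∫ q, f e q * envelope a b k f q ≤ natEntropy (f e) + k * sigmaMax a b f := by
  have hf := h.isChannel
  have hs := hf.stdDev_pos he
  have i1 : HasIntegralValue (f e) 1 := ⟨hf.integrable he, hf.integral_eq_one e he⟩
  have i2 : HasIntegralValue (fun q => f e q * |(q - mean f e) / stdDev f e|)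
      (∫ x, shape f e x * |x|) :=
    ⟨(hf.integrable_shape_mul_iff he _).1 (hf.integrable_shape_mul he continuous_abs),
      (hf.integral_shape_mul he fun x => |x|).symm⟩
  have := (hf.integrable_mul he (continuous_envelope h.lt hk hC)).hasIntegralValue.mono
    ((i1.mul_const (natEntropy (f e))).add (i2.const_mul (k * stdDev f e))) fun q => by
      have h1 := mul_le_mul_of_nonneg_left (envelope_le hk hC he q) (hf.nonneg e he q)
      have h2 : |q - mean f e| = stdDev f e * |(q - mean f e) / stdDev f e| := by
        rw [abs_div, abs_of_pos hs]; field_simp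
      rw [h2] at h1
      linarith
  have h3 := hf.integral_shape_mul_abs_le he
  have h4 := hf.stdDev_le_sigmaMax he
  have h5 : k * stdDev f e * (∫ x, shape f e x * |x|) ≤ k * sigmaMax a b f * 1 := by
    have : 0 ≤ ∫ x, shape f e x * |x| :=
      integral_nonneg fun x => mul_nonneg (hf.shape_nonneg he x) (abs_nonneg x)
    have := h.sigmaMax_pos
    gcongr
  linarith

theorem natEntropy_outputDensity_sub_le {p : ℝ → ℝ} (hp : IsInputDensity a b p) {C : ℝ}
    (hC : ∀ e ∈ Ioo a b, |natEntropy (f e)| ≤ C) {k W : ℝ} (hk : 0 ≤ k)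
    (hi : Integrable (fun q => Real.exp (-envelope a b k f q))) (hW : 0 < W)
    (hle : ∫ q, Real.exp (-envelope a b k f q) ≤ W) :
    natEntropy (outputDensity f p) - ∫ e, natEntropy (f e) * p e ≤
      Real.log W + k * sigmaMax a b f := by
  have hf := h.isChannel
  have hcont := continuous_envelope h.lt hk hC
  have h1 := natEntropy_outputDensity_le hf hp hC (G := fun q => -envelope a b k f q)
    (HasBoundedMoment.comp_snd hf hcont.neg) hi hW hle
  simp only [mul_neg, integral_neg, neg_mul, sub_neg_eq_add] at h1
  have hH : Integrable (fun e => (∫ q, f e q * envelope a b k f q) * p e) := by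
    have := ((HasBoundedMoment.comp_snd hf hcont).integrable_joint hf hp).integral_prod_left
    refine this.congr (Eventually.of_forall fun e => ?_)
    simp only
    rw [← integral_mul_const]
    congr 1; ext q; ring
  have hpI : HasIntegralValue p 1 := ⟨hp.integrable, hp.integral_eq_one⟩
  have h2 := hH.hasIntegralValue.mono
    ((integrable_natEntropy_mul hf hp hC).hasIntegralValue.add
      (hpI.const_mul (k * sigmaMax a b f))) fun e => by
      by_cases he : e ∈ Ioo a b
      · have := mul_le_mul_of_nonneg_right (h.integral_mul_envelope_le hC hk he) (hp.nonneg e)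
        linarith
      · simp [hp.eq_zero e he]
  linarith

end SlowChannel

/-- The upper bound: no input density does much better than `log N`. -/
theorem exists_upper_bound {a b c : ℝ} (hab : a < b) (hc : 0 < c) (Bf : ℝ → ℝ)
    (hBf : ∀ η, 0 < η → 3 ≤ Bf η) {ε : ℝ} (hε : 0 < ε) :
    ∃ δ₀ > 0, ∃ s₀ > 0, ∀ (qm qM δ : ℝ) (f : ℝ → ℝ → ℝ), SlowChannel a b qm qM c δ f → δ ≤ δ₀ →
      sigmaMax a b f ≤ s₀ → (∀ η, 0 < η → PeakBound a b (Bf η) η f) →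
        ∀ p, IsInputDensity a b p → natEntropy (outputDensity f p) -
          ∫ e, natEntropy (f e) * p e ≤ Real.log (normConst a b f) + 3 * ε := by
  -- the tails of the reference density then have mass at most `12 N / (c K ε) = ε N`
  set K := 12 / (c * ε ^ 2) with hK
  have hK0 : 0 < K := by positivity
  set ω := min (1 / (1 + K)) (min (ε * c) ε) with hω
  have hω0 : 0 < ω := by positivity
  obtain ⟨δ₀, hδ₀, H⟩ := exists_natEntropy_close c hc Bf hBf hω0
  refine ⟨δ₀, hδ₀, (b - a) / (2 * K), by have := sub_pos.2 hab; positivity, ?_⟩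
  intro qm qM δ f h hδ hs hpk p hp
  obtain ⟨C, hC⟩ := h.exists_abs_natEntropy_le (hBf 1 one_pos) (hpk 1 one_pos)
  have hσ := h.sigmaMax_pos
  have hL : ∀ e ∈ Ioo a b, ∀ e' ∈ Ioo a b,
      |natEntropy (f e) - natEntropy (f e')| ≤ ω * (1 + |e - e'| / sigmaMax a b f) :=
    fun e he e' he' => abs_sub_le_of_step (g := fun e => natEntropy (f e)) hσ hω0.le
      (H a b qm qM δ f h hδ hpk) he he'
  set k := ε / sigmaMax a b f with hk
  have hk0 : 0 < k := by positivity
  have hkσ : k * sigmaMax a b f = ε := div_mul_cancel₀ _ hσ.ne'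
  have hN := h.normConst_pos hC
  set N := normConst a b f with hNdef
  set S := N * Real.exp (ω * (1 + K)) / (c * K * sigmaMax a b f) with hS
  have hKσ : 2 * (K * sigmaMax a b f) ≤ b - a := by
    rw [le_div_iff₀ (by positivity)] at hs; linarith
  obtain ⟨hi, hle⟩ := h.integral_exp_neg_envelope hC hk0 (ω := ω) (S := S)
    (fun e he => by
      have := h.le_envelope (k := k) hω0.le hL (by
        rw [hkσ]; exact (min_le_right _ _).trans (min_le_left _ _)) he (mean f e)
      simpa using this)
    (fun e he => h.exp_neg_natEntropy_le hC hω0.le hK0 hKσ hL he)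
  have hω1 : Real.exp (ω * (1 + K)) ≤ 3 := by
    have : ω * (1 + K) ≤ 1 := by
      calc ω * (1 + K) ≤ 1 / (1 + K) * (1 + K) := by gcongr; exact min_le_left _ _
        _ = 1 := by field_simp
    linarith [Real.exp_le_exp.2 this, Real.exp_one_lt_d9]
  have hωε : ω ≤ ε := (min_le_right _ _).trans (min_le_right _ _)
  have htail : 4 * S / k ≤ ε * N := by
    have h1 : 4 * S / k = N * (4 * Real.exp (ω * (1 + K)) / (c * K * ε)) := by
      rw [hS, hk]; field_simp
    have h2 : c * K * ε = 12 / ε := by rw [hK]; field_simp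
    rw [h1, h2, mul_comm ε]
    gcongr
    rw [div_le_iff₀ (by positivity)]
    have : ε * (12 / ε) = 12 := by field_simp
    linarith
  have hW : Real.exp ω * N + 4 * S / k ≤ Real.exp (2 * ε) * N := by
    have h1 : Real.exp ω ≤ Real.exp ε := Real.exp_le_exp.2 hωε
    have h2 : Real.exp ε + ε ≤ Real.exp (2 * ε) := by
      rw [two_mul, Real.exp_add]
      nlinarith [Real.add_one_le_exp ε, Real.exp_pos ε]
    nlinarith
  have := h.natEntropy_outputDensity_sub_le hp hC hk0.le hi (by positivity) (hle.trans hW)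
  rw [Real.log_mul (Real.exp_pos _).ne' hN.ne', Real.log_exp, hkσ] at this
  linarith

/-! ### The posterior weight of typical inputs -/

namespace SlowChannel

variable {a b qm qM c δ : ℝ} {f : ℝ → ℝ → ℝ} (h : SlowChannel a b qm qM c δ f)
include h

theorem measurableSet_typical (X q : ℝ) :
    MeasurableSet {e | |q - mean f e| ≤ X * stdDev f e} :=
  measurableSet_le (measurable_const.sub h.isChannel.measurable_mean).norm
    (h.isChannel.measurable_stdDev.const_mul X)

/-- For a fixed output `q`, the weights `m'(e) f(q|e)` of the inputs for which `q` is within `X`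
standard deviations of the mean have total mass at most about `1`. The substitution is
`x = (q - m(e)) / σ(e)`; the densities at varying `e` are replaced by the one at the smallest input
for `x ≥ 0` and by the one at the largest input for `x < 0`, since these are the directions in which
`shape_le_of_nonneg` and `shape_le_of_nonpos` apply. -/
theorem lintegral_Icc_typical_le {X τ D : ℝ} (hX : 0 < X) (hδX : δ * X < c)
    (hTV : ∀ e ∈ Ioo a b, ∀ e' ∈ Ioo a b, |e - e'| ≤ 2 * X / c * sigmaMax a b f →
      ∫ x, |shape f e x - shape f e' x| ≤ τ)
    (hD : Real.exp (δ * (2 * X / c)) ≤ D * (1 - δ * X / c)) {a' b' : ℝ} (ha : a < a') (hb : b' < b)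
    (q : ℝ) :
    ∫⁻ e in Icc a' b' ∩ {e | |q - mean f e| ≤ X * stdDev f e},
      ENNReal.ofReal (deriv (mean f) e * f e q) ≤ ENNReal.ofReal (D * (1 + τ)) := by
  set S := Icc a' b' ∩ {e | |q - mean f e| ≤ X * stdDev f e} with hS
  have hSm : MeasurableSet S := measurableSet_Icc.inter (h.measurableSet_typical X q)
  rcases S.eq_empty_or_nonempty with hemp | hne
  · rw [hemp]; simp
  have hf := h.isChannel
  have hc := h.slope_pos
  have hσ := h.sigmaMax_pos
  have hcpos : 0 < 1 - δ * X / c := by rw [sub_pos, div_lt_one hc]; exact hδX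
  have hDpos : 0 < D := pos_of_mul_pos_left ((Real.exp_pos _).trans_le hD) hcpos.le
  have hSI : S ⊆ Ioo a b := fun e he => ⟨ha.trans_le he.1.1, he.1.2.trans_lt hb⟩
  have hbelow : BddBelow S := ⟨a', fun e he => he.1.1⟩
  have habove : BddAbove S := ⟨b', fun e he => he.1.2⟩
  obtain ⟨r₀, hr₀⟩ := hne
  have hne : S.Nonempty := ⟨r₀, hr₀⟩
  set e₁ := sInf S
  set e₂ := sSup S
  have hle₁ : ∀ e ∈ S, e₁ ≤ e := fun e he => csInf_le hbelow he
  have hle₂ : ∀ e ∈ S, e ≤ e₂ := fun e he => le_csSup habove he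
  have h12 : e₁ ≤ e₂ := (hle₁ r₀ hr₀).trans (hle₂ r₀ hr₀)
  have he₁ : e₁ ∈ Ioo a b := ⟨ha.trans_le (le_csInf hne fun e he => he.1.1),
    (hle₁ r₀ hr₀).trans_lt (hSI hr₀).2⟩
  have he₂ : e₂ ∈ Ioo a b := ⟨(hSI hr₀).1.trans_le (hle₂ r₀ hr₀),
    (csSup_le hne fun e he => he.1.2).trans_lt hb⟩
  have hdiam : e₂ - e₁ ≤ 2 * X / c * sigmaMax a b f := by
    have hpair : ∀ r ∈ S, ∀ s ∈ S, r - s ≤ 2 * X / c * sigmaMax a b f := fun r hr s hs => by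
      have h1 := h.mul_abs_sub_le (hSI hr) (hSI hs)
      have h2 := abs_sub_le (mean f r) q (mean f s)
      have h3 : X * stdDev f r ≤ X * sigmaMax a b f := by
        gcongr; exact hf.stdDev_le_sigmaMax (hSI hr)
      have h4 : X * stdDev f s ≤ X * sigmaMax a b f := by
        gcongr; exact hf.stdDev_le_sigmaMax (hSI hs)
      have h5 : |q - mean f r| ≤ X * stdDev f r := hr.2
      have h6 : |q - mean f s| ≤ X * stdDev f s := hs.2
      rw [abs_sub_comm (mean f r) q] at h2
      have h7 : c * (r - s) ≤ 2 * X * sigmaMax a b f :=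
        (mul_le_mul_of_nonneg_left (le_abs_self _) hc.le).trans (by linarith)
      rw [div_mul_eq_mul_div, le_div_iff₀ hc]
      linarith
    rw [sub_le_comm]
    refine le_csInf hne fun s hs => ?_
    rw [sub_le_comm, sub_le_iff_le_add]
    refine csSup_le hne fun r hr => ?_
    linarith [hpair r hr s hs]
  -- the standardised output as a function of the input, and its derivative
  set x : ℝ → ℝ := fun e => (q - mean f e) / stdDev f e with hx
  set x' : ℝ → ℝ := fun e => (-deriv (mean f) e * stdDev f e -
    (q - mean f e) * deriv (stdDev f) e) / stdDev f e ^ 2 with hx'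
  have hxd : ∀ e ∈ S, HasDerivWithinAt x (x' e) S e := fun e he =>
    (((h.slow.mean_differentiable e (hSI he)).hasDerivAt.const_sub q).div
      (h.slow.stdDev_differentiable e (hSI he)).hasDerivAt
      (hf.stdDev_pos (hSI he)).ne').hasDerivWithinAt
  have hxX : ∀ e ∈ S, |x e| ≤ X := fun e he => by
    have hs := hf.stdDev_pos (hSI he)
    rw [hx, abs_div, abs_of_pos hs, div_le_iff₀ hs]
    exact he.2
  have hδx : ∀ e ∈ S, δ * |x e| < c := fun e he =>
    (mul_le_mul_of_nonneg_left (hxX e he) h.delta_nonneg).trans_lt hδX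
  have hout : ∀ e ∈ S, mean f e + stdDev f e * x e = q := fun e he => by
    have hs := hf.stdDev_pos (hSI he)
    simp only [hx]; field_simp; ring
  have hinj : InjOn x S := fun r hr s hs hrs => by
    have h1 := hout r hr
    rw [hrs] at h1
    exact (h.strictMonoOn_output (hδx s hs)).injOn (hSI hr) (hSI hs)
      (h1.trans (hout s hs).symm)
  set ψ : ℝ → ℝ := fun y => if 0 ≤ y then shape f e₁ y else shape f e₂ y with hψ
  have hψ0 : ∀ y, 0 ≤ ψ y := fun y => by
    simp only [hψ]; split_ifs
    exacts [hf.shape_nonneg he₁ y, hf.shape_nonneg he₂ y]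
  have hψm : Measurable ψ := Measurable.ite measurableSet_Ici (hf.measurable_shape _)
    (hf.measurable_shape _)
  have hψle : ∀ y, ψ y ≤ shape f e₁ y + |shape f e₁ y - shape f e₂ y| := fun y => by
    simp only [hψ]; split_ifs
    · linarith [abs_nonneg (shape f e₁ y - shape f e₂ y)]
    · linarith [neg_abs_le (shape f e₁ y - shape f e₂ y)]
  have i1 : HasIntegralValue (shape f e₁) 1 := ⟨hf.integrable_shape he₁, hf.integral_shape he₁⟩
  have i2 := ((hf.integrable_shape he₁).sub (hf.integrable_shape he₂)).abs.hasIntegralValue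
  have hψi : Integrable ψ := (i1.add i2).1.mono' hψm.aestronglyMeasurable
    (Eventually.of_forall fun y => by rw [Real.norm_of_nonneg (hψ0 y)]; exact hψle y)
  have hψint : ∫ y, ψ y ≤ 1 + τ := by
    refine (hψi.hasIntegralValue.mono (i1.add i2) hψle).trans ?_
    have := hTV e₁ he₁ e₂ he₂ (by rwa [abs_sub_comm, abs_of_nonneg (sub_nonneg.2 h12)])
    simp only [Pi.sub_apply]
    linarith
  have hpt : ∀ e ∈ S, deriv (mean f) e * f e q ≤ |x' e| * (D * ψ (x e)) := fun e he => by
    have heI := hSI he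
    have hs := hf.stdDev_pos heI
    have hm' := h.deriv_mean_pos heI
    have hshape : shape f e (x e) = stdDev f e * f e q := by rw [shape, hout e he]
    have hexp : Real.exp (δ / sigmaMax a b f * (e₂ - e₁)) ≤ D * (1 - δ * X / c) := by
      refine le_trans (Real.exp_le_exp.2 ?_) hD
      calc δ / sigmaMax a b f * (e₂ - e₁)
          ≤ δ / sigmaMax a b f * (2 * X / c * sigmaMax a b f) := by
            gcongr; exact div_nonneg h.delta_nonneg hσ.le
        _ = δ * (2 * X / c) := by field_simp
    have hL0 : 0 ≤ δ / sigmaMax a b f := div_nonneg h.delta_nonneg hσ.le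
    have hcmp : stdDev f e * f e q ≤ D * (1 - δ * X / c) * ψ (x e) := by
      rw [← hshape]
      simp only [hψ]
      split_ifs with h0
      · refine (h.shape_le_of_nonneg (hle₁ e he) he₁ heI h0 (hδx e he)).trans ?_
        gcongr
        · exact hf.shape_nonneg he₁ _
        · refine le_trans (Real.exp_le_exp.2 ?_) hexp
          gcongr; exact hle₂ e he
      · refine (h.shape_le_of_nonpos (hle₂ e he) heI he₂ (not_le.1 h0).le (hδx e he)).trans ?_
        gcongr
        · exact hf.shape_nonneg he₂ _
        · refine le_trans (Real.exp_le_exp.2 ?_) hexp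
          gcongr; exact hle₁ e he
    have hder : deriv (mean f) e * (1 - δ * X / c) ≤ stdDev f e * |x' e| := by
      have h1 : stdDev f e * |x' e| = |deriv (mean f) e + x e * deriv (stdDev f) e| := by
        rw [← abs_neg (deriv (mean f) e + x e * deriv (stdDev f) e)]
        rw [show stdDev f e * |x' e| = |stdDev f e * x' e| by rw [abs_mul, abs_of_pos hs]]
        congr 1
        simp only [hx, hx']
        field_simp
        ring
      have h2 : |x e * deriv (stdDev f) e| ≤ X * δ := by
        rw [abs_mul]
        have := hxX e he
        have := h.abs_deriv_stdDev_le heI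
        gcongr
      have h3 : X * δ ≤ deriv (mean f) e * (δ * X / c) := by
        have := h.le_slope e heI
        calc X * δ = c * (δ * X / c) := by field_simp
          _ ≤ _ := by
            gcongr
            exact div_nonneg (mul_nonneg h.delta_nonneg hX.le) hc.le
      rw [h1]
      refine le_trans ?_ (le_abs_self _)
      linarith [neg_abs_le (x e * deriv (stdDev f) e)]
    have h3 : stdDev f e * (deriv (mean f) e * f e q) ≤
        stdDev f e * (|x' e| * (D * ψ (x e))) := by
      calc stdDev f e * (deriv (mean f) e * f e q)
          = deriv (mean f) e * (stdDev f e * f e q) := by ring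
        _ ≤ deriv (mean f) e * (D * (1 - δ * X / c) * ψ (x e)) := by gcongr
        _ = deriv (mean f) e * (1 - δ * X / c) * (D * ψ (x e)) := by ring
        _ ≤ stdDev f e * |x' e| * (D * ψ (x e)) := by
            gcongr; exact mul_nonneg hDpos.le (hψ0 _)
        _ = _ := by ring
    exact le_of_mul_le_mul_left h3 hs
  calc ∫⁻ e in S, ENNReal.ofReal (deriv (mean f) e * f e q)
      ≤ ∫⁻ e in S, ENNReal.ofReal |x' e| * ENNReal.ofReal (D * ψ (x e)) := by
        refine setLIntegral_mono' hSm fun e he => ?_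
        rw [← ENNReal.ofReal_mul (abs_nonneg _)]
        exact ENNReal.ofReal_le_ofReal (hpt e he)
    _ = ∫⁻ y in x '' S, ENNReal.ofReal (D * ψ y) :=
        (lintegral_image_eq_lintegral_abs_deriv_mul hSm hxd hinj
          fun y => ENNReal.ofReal (D * ψ y)).symm
    _ ≤ ∫⁻ y, ENNReal.ofReal (D * ψ y) := setLIntegral_le_lintegral _ _
    _ = ENNReal.ofReal (∫ y, D * ψ y) :=
        (ofReal_integral_eq_lintegral_ofReal (hψi.const_mul D)
          (Eventually.of_forall fun y => mul_nonneg hDpos.le (hψ0 y))).symm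
    _ ≤ _ := by
        rw [integral_const_mul]
        exact ENNReal.ofReal_le_ofReal (by gcongr)

/-- The bound of `lintegral_Icc_typical_le` over all inputs, by monotone convergence from compact
intervals. -/
theorem hasIntegral_typical_le {X τ D : ℝ} (hX : 0 < X) (hτ : 0 ≤ τ) (hδX : δ * X < c)
    (hTV : ∀ e ∈ Ioo a b, ∀ e' ∈ Ioo a b, |e - e'| ≤ 2 * X / c * sigmaMax a b f →
      ∫ x, |shape f e x - shape f e' x| ≤ τ)
    (hD : Real.exp (δ * (2 * X / c)) ≤ D * (1 - δ * X / c)) (q : ℝ) :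
    Integrable ((Ioo a b ∩ {e | |q - mean f e| ≤ X * stdDev f e}).indicator
        fun e => deriv (mean f) e * f e q) ∧
      ∫ e, (Ioo a b ∩ {e | |q - mean f e| ≤ X * stdDev f e}).indicator
        (fun e => deriv (mean f) e * f e q) e ≤ D * (1 + τ) := by
  have hf := h.isChannel
  set T := {e | |q - mean f e| ≤ X * stdDev f e} with hT
  have hTm : MeasurableSet T := h.measurableSet_typical X q
  have hcpos : 0 < 1 - δ * X / c := by rw [sub_pos, div_lt_one h.slope_pos]; exact hδX
  have hDpos : 0 < D := pos_of_mul_pos_left ((Real.exp_pos _).trans_le hD) hcpos.le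
  set J : ℕ → Set ℝ := fun n => Icc (a + 1 / ((n : ℝ) + 1)) (b - 1 / ((n : ℝ) + 1)) ∩ T with hJ
  have hunion : Ioo a b ∩ T = ⋃ n, J n := by
    ext e
    simp only [hJ, mem_iUnion, mem_inter_iff, mem_Ioo, mem_Icc]
    constructor
    · rintro ⟨⟨h1, h2⟩, h3⟩
      obtain ⟨n, hn⟩ := exists_nat_one_div_lt (lt_min (sub_pos.2 h1) (sub_pos.2 h2))
      have h4 := hn.trans_le (min_le_left _ _)
      have h5 := hn.trans_le (min_le_right _ _)
      exact ⟨n, ⟨by linarith, by linarith⟩, h3⟩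
    · rintro ⟨n, ⟨h1, h2⟩, h3⟩
      have : 0 < 1 / ((n : ℝ) + 1) := by positivity
      exact ⟨⟨by linarith, by linarith⟩, h3⟩
  have hmono : Monotone J := fun n n' hnn' => by
    have : 1 / ((n' : ℝ) + 1) ≤ 1 / ((n : ℝ) + 1) := by gcongr
    exact inter_subset_inter_left _ (Icc_subset_Icc (by linarith) (by linarith))
  have hlint : ∫⁻ e in Ioo a b ∩ T, ENNReal.ofReal (deriv (mean f) e * f e q) ≤
      ENNReal.ofReal (D * (1 + τ)) := by
    rw [hunion, setLIntegral_iUnion_of_directed _ hmono.directed_le]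
    refine iSup_le fun n => ?_
    have : 0 < 1 / ((n : ℝ) + 1) := by positivity
    exact h.lintegral_Icc_typical_le hX hδX hTV hD (by linarith) (by linarith) q
  have hmeas : Measurable (fun e => deriv (mean f) e * f e q) :=
    (measurable_deriv _).mul (hf.measurable.comp measurable_prodMk_right)
  have hnn : 0 ≤ᵐ[volume.restrict (Ioo a b ∩ T)] fun e => deriv (mean f) e * f e q := by
    filter_upwards [ae_restrict_mem (measurableSet_Ioo.inter hTm)] with e he
    exact mul_nonneg (h.deriv_mean_pos he.1).le (hf.nonneg e he.1 q)
  have hi : IntegrableOn (fun e => deriv (mean f) e * f e q) (Ioo a b ∩ T) :=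
    ⟨hmeas.aestronglyMeasurable, by
      rw [hasFiniteIntegral_iff_ofReal hnn]
      exact hlint.trans_lt ENNReal.ofReal_lt_top⟩
  refine ⟨hi.integrable_indicator (measurableSet_Ioo.inter hTm), ?_⟩
  rw [integral_indicator (measurableSet_Ioo.inter hTm),
    integral_eq_lintegral_of_nonneg_ae hnn hmeas.aestronglyMeasurable]
  exact ENNReal.toReal_le_of_le_ofReal (by positivity) hlint

/-! ### The lower bound -/

/-- A Cauchy kernel in the mean `m(e)`, integrated over the inputs with weight `m'(e)`, has mass at
most `π`, whatever its scale. -/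
theorem hasIntegral_cauchy_le {s : ℝ} (hs : 0 < s) (q : ℝ) :
    Integrable ((Ioo a b).indicator
        fun e => deriv (mean f) e * (s * (1 + ((q - mean f e) * s) ^ 2)⁻¹)) ∧
      ∫ e, (Ioo a b).indicator
        (fun e => deriv (mean f) e * (s * (1 + ((q - mean f e) * s) ^ 2)⁻¹)) e ≤ Real.pi := by
  set k : ℝ → ℝ := fun u => s * (1 + ((q - u) * s) ^ 2)⁻¹ with hk
  have hk' : k = fun u => s * (fun y : ℝ => (1 + y ^ 2)⁻¹) (-(q * s) + s * u) := by
    ext u; simp only [hk]; ring_nf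
  have hki : Integrable k := hk' ▸ integrable_comp_affine _ hs integrable_inv_one_add_sq
  have hkv : ∫ u, k u = Real.pi := by
    rw [hk', ← integral_univ_inv_one_add_sq]
    exact integral_comp_affine (fun y => (1 + y ^ 2)⁻¹) _ hs
  have hk0 : ∀ u, 0 ≤ k u := fun u => by positivity
  have hcongr : ∀ e ∈ Ioo a b, |deriv (mean f) e| • k (mean f e) =
      deriv (mean f) e * (s * (1 + ((q - mean f e) * s) ^ 2)⁻¹) := fun e he => by
    rw [abs_of_pos (h.deriv_mean_pos he), smul_eq_mul]
  have hi := ((integrableOn_image_iff_integrableOn_abs_deriv_smul measurableSet_Ioo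
    h.hasDerivWithinAt_mean h.strictMonoOn_mean.injOn k).1 hki.integrableOn).congr_fun hcongr
      measurableSet_Ioo
  refine ⟨hi.integrable_indicator measurableSet_Ioo, ?_⟩
  rw [integral_indicator measurableSet_Ioo, ← setIntegral_congr_fun measurableSet_Ioo hcongr,
    ← integral_image_eq_integral_abs_deriv_smul measurableSet_Ioo
    h.hasDerivWithinAt_mean h.strictMonoOn_mean.injOn, ← hkv]
  exact setIntegral_le_integral hki (Eventually.of_forall hk0)

end SlowChannel

/-- The nearly optimal input density `m'(e) 2 ^ (-h(Q|e)) / N`. -/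
noncomputable def nearOptimalInput (eMin eMax : ℝ) (f : ℝ → ℝ → ℝ) : ℝ → ℝ :=
  (Ioo eMin eMax).indicator fun e =>
    deriv (mean f) e * Real.exp (-natEntropy (f e)) / normConst eMin eMax f

namespace SlowChannel

variable {a b qm qM c δ : ℝ} {f : ℝ → ℝ → ℝ} (h : SlowChannel a b qm qM c δ f)
include h

theorem isInputDensity_nearOptimalInput {C : ℝ} (hC : ∀ e ∈ Ioo a b, |natEntropy (f e)| ≤ C) :
    IsInputDensity a b (nearOptimalInput a b f) where
  measurable := (((measurable_deriv _).mul
    h.isChannel.measurable_natEntropy.neg.exp).div_const _).indicator measurableSet_Ioo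
  nonneg e := indicator_nonneg (fun e he => by
    have := h.deriv_mean_pos he
    have := h.normConst_pos hC
    positivity) e
  eq_zero e he := indicator_of_notMem he _
  integral_eq_one := by
    rw [nearOptimalInput, integral_indicator measurableSet_Ioo, integral_div, ← h.normConst_eq,
      div_self (h.normConst_pos hC).ne']

/-- The contribution of outputs more than `X` standard deviations from the mean. -/
theorem integral_tail_le {B η X D : ℝ} (hB : 1 ≤ B) (hp : PeakBound a b B η f) (hX : 0 < X)
    (hD : 0 ≤ D) {e : ℝ} (he : e ∈ Ioo a b) :
    ∫ q, f e q * {z : ℝ × ℝ | X * stdDev f z.1 < |z.2 - mean f z.1|}.indicator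
      (fun z => Real.log (f z.1 z.2) + (Real.log (stdDev f z.1) + D +
        5 * |(z.2 - mean f z.1) / stdDev f z.1|)) (e, q) ≤
      η + (Real.log B + D) / X ^ 2 + 5 / X := by
  have hf := h.isChannel
  have hs := hf.stdDev_pos he
  have hlogB := Real.log_nonneg hB
  set g : ℝ → ℝ := {x | X < |x|}.indicator
    fun x => Real.log (shape f e x) + D + 5 * |x| with hg
  have hXm : MeasurableSet {x : ℝ | X < |x|} := measurableSet_lt measurable_const measurable_norm
  have hXm' : MeasurableSet {x : ℝ | X ≤ |x|} := measurableSet_le measurable_const measurable_norm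
  have heq : ∫ q, f e q * {z : ℝ × ℝ | X * stdDev f z.1 < |z.2 - mean f z.1|}.indicator
      (fun z => Real.log (f z.1 z.2) + (Real.log (stdDev f z.1) + D +
        5 * |(z.2 - mean f z.1) / stdDev f z.1|)) (e, q) = ∫ x, shape f e x * g x := by
    rw [hf.integral_shape_mul he g]
    refine integral_congr_ae (Eventually.of_forall fun q => ?_)
    simp only [hg]
    rcases eq_or_ne (f e q) 0 with h0 | h0
    · simp [h0]
    have hiff : (e, q) ∈ {z : ℝ × ℝ | X * stdDev f z.1 < |z.2 - mean f z.1|} ↔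
        (q - mean f e) / stdDev f e ∈ {x : ℝ | X < |x|} := by
      simp only [mem_ofPred_eq, abs_div, abs_of_pos hs, lt_div_iff₀ hs]
    by_cases hq : (e, q) ∈ {z : ℝ × ℝ | X * stdDev f z.1 < |z.2 - mean f z.1|}
    · rw [indicator_of_mem hq, indicator_of_mem (hiff.1 hq), shape,
        mul_div_cancel₀ _ hs.ne', add_sub_cancel, Real.log_mul hs.ne' h0]
      ring
    · rw [indicator_of_notMem hq, indicator_of_notMem (fun hx => hq (hiff.2 hx))]
  have i0 := hf.integrable_shape_mul_log he
  have i1 := hf.integrable_shape he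
  have i2 := hf.integrable_shape_mul he continuous_abs
  have hint : Integrable (fun x => shape f e x * g x) := by
    refine (((i0.add (i1.mul_const D)).add (i2.mul_const 5)).indicator hXm).congr
      (Eventually.of_forall fun x => ?_)
    simp only [hg]
    by_cases hx : x ∈ {x : ℝ | X < |x|}
    · rw [indicator_of_mem hx, indicator_of_mem hx]
      simp only [Pi.add_apply]; ring
    · rw [indicator_of_notMem hx, indicator_of_notMem hx, mul_zero]
  rw [heq]
  have := hint.hasIntegralValue.mono
    (((hf.integrable_peak he (B := B)).hasIntegralValue.add
      ((i1.indicator hXm').hasIntegralValue.mul_const (Real.log B + D))).add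
      ((i2.indicator hXm').hasIntegralValue.mul_const 5)) fun x => by
    have hpk := IsChannel.peak_nonneg (f := f) (e := e) hB x
    have n := hf.shape_nonneg he x
    by_cases hx : x ∈ {x : ℝ | X < |x|}
    · have hx' : x ∈ {x : ℝ | X ≤ |x|} :=
        le_of_lt (show X < |x| from hx)
      have := hf.shape_mul_log_le he hB x
      rw [hg, indicator_of_mem hx, indicator_of_mem hx', indicator_of_mem hx']
      linarith
    · rw [hg, indicator_of_notMem hx, mul_zero]
      have h1 : 0 ≤ {x : ℝ | X ≤ |x|}.indicator (shape f e) x :=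
        indicator_nonneg (fun x _ => hf.shape_nonneg he x) x
      have h2 : 0 ≤ {x : ℝ | X ≤ |x|}.indicator (fun x => shape f e x * |x|) x :=
        indicator_nonneg (fun x _ => mul_nonneg (hf.shape_nonneg he x) (abs_nonneg x)) x
      positivity
  rw [integral_indicator hXm', integral_indicator hXm'] at this
  have t1 := hf.integral_peak_le he hp
  have t2 := mul_le_mul_of_nonneg_right (hf.setIntegral_shape_le he hX) (add_nonneg hlogB hD)
  have t3 := mul_le_mul_of_nonneg_right (hf.setIntegral_shape_mul_abs_le he hX)
    (show (0 : ℝ) ≤ 5 by norm_num)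
  have e1 : 1 / X ^ 2 * (Real.log B + D) = (Real.log B + D) / X ^ 2 := by ring
  have e2 : 1 / X * 5 = 5 / X := by ring
  linarith

end SlowChannel

namespace SlowChannel

variable {a b qm qM c δ : ℝ} {f : ℝ → ℝ → ℝ} (h : SlowChannel a b qm qM c δ f)
include h

/-- The information of the nearly optimal input, by the variational bound. The kernel from outputs
to inputs is `m'(e) f(q|e)` for the typical pairs, plus a little Cauchy density, whose scale
`exp (H q)` is comparable to the standard deviation at typical inputs, for all pairs. -/
theorem le_natEntropy_outputDensity_sub {C C₀ ω M ε X t : ℝ}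
    (hC : ∀ e ∈ Ioo a b, |natEntropy (f e)| ≤ C)
    (hC₀ : ∀ e ∈ Ioo a b, |natEntropy (f e) - Real.log (stdDev f e)| ≤ C₀)
    (hω : 0 ≤ ω) (hω1 : ω ≤ 1) (hωc : ω ≤ c)
    (hL : ∀ e ∈ Ioo a b, ∀ e' ∈ Ioo a b,
      |natEntropy (f e) - natEntropy (f e')| ≤ ω * (1 + |e - e'| / sigmaMax a b f))
    (hM : ∀ q, Integrable ((Ioo a b ∩ {e | |q - mean f e| ≤ X * stdDev f e}).indicator
        fun e => deriv (mean f) e * f e q) ∧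
      ∫ e, (Ioo a b ∩ {e | |q - mean f e| ≤ X * stdDev f e}).indicator
        (fun e => deriv (mean f) e * f e q) e ≤ M)
    (hM0 : 0 ≤ M) (hε : 0 < ε)
    (ht : ∀ e ∈ Ioo a b,
      ∫ q, f e q * {z : ℝ × ℝ | X * stdDev f z.1 < |z.2 - mean f z.1|}.indicator
        (fun z => Real.log (f z.1 z.2) + (Real.log (stdDev f z.1) +
          (Real.log (Real.pi / ε) + 3 * C₀ + 3) +
          5 * |(z.2 - mean f z.1) / stdDev f z.1|)) (e, q) ≤ t) :
    Real.log (normConst a b f) - Real.log (M + ε) - t ≤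
      natEntropy (outputDensity f (nearOptimalInput a b f)) -
        ∫ e, natEntropy (f e) * nearOptimalInput a b f e := by
  have hf := h.isChannel
  have hσ := h.sigmaMax_pos
  have hN := h.normConst_pos hC
  have hp := h.isInputDensity_nearOptimalInput hC
  have hMε : 0 < M + ε := by linarith
  set N := normConst a b f with hNdef
  set p := nearOptimalInput a b f with hpdef
  set D := Real.log (Real.pi / ε) + 3 * C₀ + 3 with hD
  set k := 1 / sigmaMax a b f with hk
  have hk0 : 0 < k := by positivity
  have hkσ : k * sigmaMax a b f = 1 := by rw [hk]; field_simp
  set H := envelope a b k f with hH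
  set A : Set (ℝ × ℝ) := {z | X * stdDev f z.1 < |z.2 - mean f z.1|} with hA
  have hAm : MeasurableSet A :=
    measurableSet_lt ((hf.measurable_stdDev.comp measurable_fst).const_mul X)
      (measurable_snd.sub (hf.measurable_mean.comp measurable_fst)).norm
  set Ψ : ℝ × ℝ → ℝ := fun z => Real.log (f z.1 z.2) + (Real.log (stdDev f z.1) + D +
    5 * |(z.2 - mean f z.1) / stdDev f z.1|) with hΨ
  have hΨA : HasBoundedMoment a b f (A.indicator Ψ) := by
    obtain ⟨C', hC'⟩ := h.exists_abs_log_stdDev_le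
    refine HasBoundedMoment.indicator hf ((HasBoundedMoment.log_density hf hC).add
      (.of_bounded hf (C := C' + |D| + 5 * ((qM - qm) * Real.exp C')) ?_ fun e he q hq => ?_)) hAm
    · have m1 : Measurable fun z : ℝ × ℝ => stdDev f z.1 :=
        hf.measurable_stdDev.comp measurable_fst
      have m2 : Measurable fun z : ℝ × ℝ => mean f z.1 :=
        hf.measurable_mean.comp measurable_fst
      exact ((Real.measurable_log.comp m1).add_const D).add
        ((((measurable_snd.sub m2).div m1).norm).const_mul 5)
    · have hs := hf.stdDev_pos he
      have hm := hf.mean_mem he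
      have h1 : |(q - mean f e) / stdDev f e| ≤ (qM - qm) * Real.exp C' := by
        have h2 : Real.exp (-C') ≤ stdDev f e :=
          (Real.le_log_iff_exp_le hs).1 (abs_le.1 (hC' e he)).1
        rw [abs_div, abs_of_pos hs, div_le_iff₀ hs]
        have h3 : |q - mean f e| ≤ qM - qm :=
          abs_le.2 ⟨by linarith [hq.1, hm.2], by linarith [hq.2, hm.1]⟩
        calc |q - mean f e| ≤ (qM - qm) * Real.exp C' * Real.exp (-C') := by
              rw [mul_assoc, ← Real.exp_add]; simpa using h3
          _ ≤ _ := by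
              have : 0 ≤ qM - qm := (abs_nonneg _).trans h3
              gcongr
      refine (abs_add_le _ _).trans ?_
      have h2 := abs_add_le (Real.log (stdDev f e)) D
      have h3 := hC' e he
      rw [abs_mul, abs_abs, abs_of_pos (show (0 : ℝ) < 5 by norm_num)]
      linarith
  have hh : HasBoundedMoment a b f fun z : ℝ × ℝ =>
      Real.log (M + ε) - Real.log N - natEntropy (f z.1) :=
    .of_bounded hf (measurable_const.sub (hf.measurable_natEntropy.comp measurable_fst))
      (C := |Real.log (M + ε) - Real.log N| + C) fun e he q _ => by
        have := abs_sub (Real.log (M + ε) - Real.log N) (natEntropy (f e))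
        linarith [hC e he]
  have hΦ := hh.add hΨA
  set lam : ℝ → ℝ → ℝ := fun e q => (M + ε)⁻¹ *
    ((Ioo a b ∩ {e | |q - mean f e| ≤ X * stdDev f e}).indicator
        (fun e => deriv (mean f) e * f e q) e + ε / Real.pi * (Ioo a b).indicator
        (fun e => deriv (mean f) e * (Real.exp (-H q) *
          (1 + ((q - mean f e) * Real.exp (-H q)) ^ 2)⁻¹)) e) with hlam
  have hlamI : ∀ q, HasIntegralValue (fun e => lam e q) _ := fun q =>
    (((hM q).1.hasIntegralValue.add
      ((h.hasIntegral_cauchy_le (Real.exp_pos (-H q)) q).1.hasIntegralValue.const_mul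
        (ε / Real.pi)))).const_mul (M + ε)⁻¹
  have hterm1 : ∀ e q, 0 ≤ (Ioo a b ∩ {e | |q - mean f e| ≤ X * stdDev f e}).indicator
        (fun e => deriv (mean f) e * f e q) e := fun e q =>
    indicator_nonneg (fun e he => mul_nonneg (h.deriv_mean_pos he.1).le (hf.nonneg e he.1 q)) e
  have hterm2 : ∀ e q, 0 ≤ ε / Real.pi * (Ioo a b).indicator
        (fun e => deriv (mean f) e * (Real.exp (-H q) *
          (1 + ((q - mean f e) * Real.exp (-H q)) ^ 2)⁻¹)) e := fun e q =>
    mul_nonneg (div_nonneg hε.le Real.pi_pos.le) (indicator_nonneg (fun e he => by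
      have := h.deriv_mean_pos he
      positivity) e)
  have hlam0 : ∀ e q, 0 ≤ lam e q := fun e q =>
    mul_nonneg (inv_pos.2 hMε).le (add_nonneg (hterm1 e q) (hterm2 e q))
  have hlam1 : ∀ q, ∫ e, lam e q ≤ 1 := fun q => by
    rw [(hlamI q).2, inv_mul_le_one₀ hMε]
    have h1 := (hM q).2
    have h2 := mul_le_mul_of_nonneg_left (h.hasIntegral_cauchy_le (Real.exp_pos (-H q)) q).2
      (div_nonneg hε.le Real.pi_pos.le)
    rw [div_mul_cancel₀ _ Real.pi_ne_zero] at h2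
    linarith
  have key := neg_natEntropy_outputDensity_le hf hp hC hΦ hlam0 (fun q => (hlamI q).1) hlam1
    fun e he q hJ => ?_
  · have hcond : ∀ e ∈ Ioo a b, ∫ q, f e q * (Real.log (M + ε) - Real.log N - natEntropy (f e) +
        A.indicator Ψ (e, q)) ≤ Real.log (M + ε) - Real.log N - natEntropy (f e) + t :=
      fun e he => by
        have i1 : HasIntegralValue (f e) 1 := ⟨hf.integrable he, hf.integral_eq_one e he⟩
        obtain ⟨-, C', hC'⟩ := hΨA
        have := (i1.mul_const (Real.log (M + ε) - Real.log N - natEntropy (f e))).add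
          (hC' e he).1.hasIntegralValue
        simp only [mul_add]
        rw [this.2, one_mul]
        linarith [ht e he]
    have hpI : HasIntegralValue p 1 := ⟨hp.integrable, hp.integral_eq_one⟩
    have hleft : Integrable (fun e => (∫ q, f e q * (Real.log (M + ε) - Real.log N -
        natEntropy (f e) + A.indicator Ψ (e, q))) * p e) := by
      refine (hΦ.integrable_joint hf hp).integral_prod_left.congr
        (Eventually.of_forall fun e => ?_)
      simp only
      rw [← integral_mul_const]
      congr 1; ext q; ring
    have := hleft.hasIntegralValue.mono
      ((hpI.const_mul (Real.log (M + ε) - Real.log N + t)).sub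
        (integrable_natEntropy_mul hf hp hC).hasIntegralValue) fun e => by
        by_cases he : e ∈ Ioo a b
        · have := mul_le_mul_of_nonneg_right (hcond e he) (hp.nonneg e)
          linarith
        · simp [hp.eq_zero e he]
    linarith
  · have hm' := h.deriv_mean_pos he
    have hs := hf.stdDev_pos he
    have hpe : p e = deriv (mean f) e * Real.exp (-natEntropy (f e)) / N := by
      rw [hpdef, nearOptimalInput, indicator_of_mem he]
    have hfpos : 0 < f e q := (hf.nonneg e he q).lt_of_ne fun h0 => by simp [← h0] at hJ
    have hJN : f e q * p e = (M + ε)⁻¹ * (deriv (mean f) e * f e q) *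
        Real.exp (Real.log (M + ε) - Real.log N - natEntropy (f e)) := by
      rw [hpe, sub_sub, Real.exp_sub, Real.exp_add, Real.exp_log hMε, Real.exp_log hN,
        Real.exp_neg]
      field_simp
    -- it suffices to bound the joint density by `lam * exp Φ`
    have suff : f e q * p e ≤ lam e q * Real.exp (Real.log (M + ε) - Real.log N -
        natEntropy (f e) + A.indicator Ψ (e, q)) → 0 < lam e q ∧
        Real.log (f e q * p e) - Real.log (lam e q) ≤
          Real.log (M + ε) - Real.log N - natEntropy (f e) + A.indicator Ψ (e, q) := by
      intro hle
      have hl : 0 < lam e q := pos_of_mul_pos_left (hJ.trans_le hle) (Real.exp_pos _).le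
      refine ⟨hl, ?_⟩
      have := Real.log_le_log hJ hle
      rw [Real.log_mul hl.ne' (Real.exp_pos _).ne', Real.log_exp] at this
      linarith
    apply suff
    rw [Real.exp_add, hJN]
    by_cases hq : (e, q) ∈ A
    · have h2 : (M + ε)⁻¹ * (ε / Real.pi * (deriv (mean f) e * (Real.exp (-H q) *
          (1 + ((q - mean f e) * Real.exp (-H q)) ^ 2)⁻¹))) ≤ lam e q := by
        have := hterm1 e q
        simp only [hlam, indicator_of_mem he]
        gcongr
        linarith
      rw [indicator_of_mem hq]
      set x := (q - mean f e) / stdDev f e with hx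
      have hqx : |q - mean f e| = stdDev f e * |x| := by
        rw [hx, abs_div, abs_of_pos hs]; field_simp
      -- the scale of the Cauchy density is comparable to the standard deviation
      have hkx : k * |q - mean f e| ≤ |x| := by
        rw [hqx, ← mul_assoc]
        refine mul_le_of_le_one_left (abs_nonneg x) ?_
        rw [← hkσ]
        have := hf.stdDev_le_sigmaMax he
        gcongr
      have hup := envelope_le hk0.le hC he q
      have hlo := h.le_envelope (k := k) hω hL (by rwa [hkσ, one_mul]) he q
      have hC0 := abs_le.1 (hC₀ e he)
      set v := C₀ + 1 + |x| with hv
      have hv0 : 0 ≤ v := by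
        have := (abs_nonneg _).trans (hC₀ e he)
        positivity
      set y := Real.log (stdDev f e) - H q with hy
      have hyv : |y| ≤ v := abs_le.2 ⟨by linarith, by linarith⟩
      have hsy : stdDev f e * Real.exp (-H q) = Real.exp y := by
        rw [hy, sub_eq_add_neg, Real.exp_add, Real.exp_log hs]
      have hqs : (q - mean f e) * Real.exp (-H q) = x * Real.exp y := by
        rw [← hsy, hx]; field_simp
      have hsq : 1 + (x * Real.exp y) ^ 2 ≤ Real.exp (2 * |x| + 2 * v) := by
        have e1 : Real.exp y ≤ Real.exp v := Real.exp_le_exp.2 ((le_abs_self _).trans hyv)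
        have e2 : 1 ≤ Real.exp v := Real.one_le_exp hv0
        have e3 : |x| + 1 ≤ Real.exp |x| := Real.add_one_le_exp _
        have e4 : (x * Real.exp y) ^ 2 ≤ |x| ^ 2 * Real.exp v ^ 2 := by
          rw [mul_pow, sq_abs]; gcongr
        have e5 : Real.exp (2 * |x| + 2 * v) = Real.exp |x| ^ 2 * Real.exp v ^ 2 := by
          rw [← Real.exp_nat_mul, ← Real.exp_nat_mul, ← Real.exp_add]; norm_num
        have e6 : 1 + |x| ^ 2 ≤ Real.exp |x| ^ 2 := by
          have := abs_nonneg x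
          nlinarith
        have e7 : 1 ≤ Real.exp v ^ 2 := one_le_pow₀ e2
        rw [e5]
        calc 1 + (x * Real.exp y) ^ 2 ≤ Real.exp v ^ 2 + |x| ^ 2 * Real.exp v ^ 2 := by linarith
          _ = (1 + |x| ^ 2) * Real.exp v ^ 2 := by ring
          _ ≤ _ := by gcongr
      have hmain : 1 ≤ ε / Real.pi * (Real.exp y * (1 + (x * Real.exp y) ^ 2)⁻¹) *
          Real.exp (D + 5 * |x|) := by
        have hpe : 0 < Real.pi / ε := div_pos Real.pi_pos hε
        have g1 : Real.exp (-v) ≤ Real.exp y := Real.exp_le_exp.2 (by linarith [(abs_le.1 hyv).1])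
        have g2 : (Real.exp (2 * |x| + 2 * v))⁻¹ ≤ (1 + (x * Real.exp y) ^ 2)⁻¹ := by gcongr
        have g3 : ε / Real.pi * (Real.exp (-v) * (Real.exp (2 * |x| + 2 * v))⁻¹) *
            Real.exp (D + 5 * |x|) = 1 := by
          rw [show ε / Real.pi = Real.exp (-Real.log (Real.pi / ε)) by
            rw [← Real.log_inv, Real.exp_log (inv_pos.2 hpe), inv_div], ← Real.exp_neg,
            ← Real.exp_add, ← Real.exp_add, ← Real.exp_add, Real.exp_eq_one_iff]
          rw [hD, hv]; ring
        refine g3.symm.le.trans ?_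
        have := Real.pi_pos
        gcongr
      have hexpΨ : Real.exp (Ψ (e, q)) = f e q * stdDev f e * Real.exp (D + 5 * |x|) := by
        simp only [hΨ]
        rw [Real.exp_add, Real.exp_log hfpos, add_assoc, Real.exp_add, Real.exp_log hs]
        ring
      rw [hexpΨ]
      have h3 : (M + ε)⁻¹ * (deriv (mean f) e * f e q) ≤
          lam e q * (f e q * stdDev f e * Real.exp (D + 5 * |x|)) := by
        calc (M + ε)⁻¹ * (deriv (mean f) e * f e q)
            = (M + ε)⁻¹ * (deriv (mean f) e * f e q) * 1 := (mul_one _).symm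
          _ ≤ (M + ε)⁻¹ * (deriv (mean f) e * f e q) * (ε / Real.pi * (Real.exp y *
              (1 + (x * Real.exp y) ^ 2)⁻¹) * Real.exp (D + 5 * |x|)) := by gcongr
          _ = (M + ε)⁻¹ * (ε / Real.pi * (deriv (mean f) e * (Real.exp (-H q) *
              (1 + ((q - mean f e) * Real.exp (-H q)) ^ 2)⁻¹))) *
              (f e q * stdDev f e * Real.exp (D + 5 * |x|)) := by
              rw [hqs, ← hsy]; ring
          _ ≤ _ := by gcongr
      calc _ ≤ lam e q * (f e q * stdDev f e * Real.exp (D + 5 * |x|)) *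
            Real.exp (Real.log (M + ε) - Real.log N - natEntropy (f e)) := by gcongr
        _ = _ := by ring
    · rw [indicator_of_notMem hq, Real.exp_zero, mul_one]
      have hmem : e ∈ Ioo a b ∩ {e | |q - mean f e| ≤ X * stdDev f e} :=
        ⟨he, show |q - mean f e| ≤ X * stdDev f e from not_lt.1 fun hlt => hq hlt⟩
      have h1 : (M + ε)⁻¹ * (deriv (mean f) e * f e q) ≤ lam e q := by
        have := hterm2 e q
        simp only [hlam]
        rw [indicator_of_mem hmem]
        gcongr
        linarith
      gcongr

end SlowChannel

/-- The lower bound: the nearly optimal input transmits almost `log N`. -/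
theorem exists_lower_bound {a b c : ℝ} (hc : 0 < c) (Bf : ℝ → ℝ)
    (hBf : ∀ η, 0 < η → 3 ≤ Bf η) {ε : ℝ} (hε : 0 < ε) (hε1 : ε ≤ 1) :
    ∃ δ₀ > 0, ∀ (qm qM δ : ℝ) (f : ℝ → ℝ → ℝ), SlowChannel a b qm qM c δ f → δ ≤ δ₀ →
      (∀ η, 0 < η → PeakBound a b (Bf η) η f) →
        Real.log (normConst a b f) - 7 * ε ≤
          natEntropy (outputDensity f (nearOptimalInput a b f)) -
            ∫ e, natEntropy (f e) * nearOptimalInput a b f e := by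
  set ω := min 1 c with hω
  have hω0 : 0 < ω := by positivity
  obtain ⟨δ₁, hδ₁, H₁⟩ := exists_natEntropy_close c hc Bf hBf hω0
  set C₀ := 2 + Real.log (Bf 1) with hC₀
  have hC₀0 : 0 ≤ C₀ := by
    have := Real.log_nonneg (show 1 ≤ Bf 1 by linarith [hBf 1 one_pos])
    linarith
  set D := Real.log (Real.pi / ε) + 3 * C₀ + 3 with hD
  have hD0 : 3 ≤ D := by
    have := Real.log_nonneg (show 1 ≤ Real.pi / ε by
      rw [le_div_iff₀ hε]; linarith [Real.pi_gt_three])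
    linarith
  have hB : 3 ≤ Bf ε := hBf ε hε
  have hlogB : 0 ≤ Real.log (Bf ε) := Real.log_nonneg (by linarith)
  set X := (Real.log (Bf ε) + D + 5) / ε with hX
  have hX1 : 1 ≤ X := by rw [hX, le_div_iff₀ hε]; linarith
  have hX0 : 0 < X := by linarith
  obtain ⟨δ₂, hδ₂, H₂⟩ := exists_shape_close c hc Bf hBf (K := 2 * X / c) (τ := ε)
    (by positivity) hε
  have hexp : 0 < 1 - Real.exp (-ε) := sub_pos.2 (Real.exp_zero ▸ Real.exp_lt_exp.2 (by linarith))
  refine ⟨min (min δ₁ δ₂) (min (ε * c / (2 * X)) ((1 - Real.exp (-ε)) * c / X)), by positivity, ?_⟩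
  intro qm qM δ f h hδ hpk
  have hδ1 : δ ≤ δ₁ := hδ.trans ((min_le_left _ _).trans (min_le_left _ _))
  have hδ2 : δ ≤ δ₂ := hδ.trans ((min_le_left _ _).trans (min_le_right _ _))
  have hδ3 : δ * (2 * X / c) ≤ ε := by
    have := hδ.trans ((min_le_right _ _).trans (min_le_left _ _))
    rw [le_div_iff₀ (by positivity)] at this
    rw [← mul_div_assoc, div_le_iff₀ hc]
    linarith
  have hδ4 : Real.exp (-ε) ≤ 1 - δ * X / c := by
    have := hδ.trans ((min_le_right _ _).trans (min_le_right _ _))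
    rw [le_div_iff₀ hX0, ← div_le_iff₀ hc] at this
    linarith
  have hδX : δ * X < c := by
    have : δ * X / c < 1 := by linarith [Real.exp_pos (-ε)]
    rwa [div_lt_one hc] at this
  obtain ⟨C, hC⟩ := h.exists_abs_natEntropy_le (hBf 1 one_pos) (hpk 1 one_pos)
  have hL : ∀ e ∈ Ioo a b, ∀ e' ∈ Ioo a b,
      |natEntropy (f e) - natEntropy (f e')| ≤ ω * (1 + |e - e'| / sigmaMax a b f) :=
    fun e he e' he' => abs_sub_le_of_step (g := fun e => natEntropy (f e)) h.sigmaMax_pos hω0.le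
      (H₁ a b qm qM δ f h hδ1 hpk) he he'
  have hM := h.hasIntegral_typical_le (X := X) (τ := ε) (D := Real.exp (2 * ε)) hX0 hε.le hδX
    (fun e he e' he' hee => (H₂ a b qm qM δ f h hδ2 hpk e he e' he' hee).1) (by
      calc Real.exp (δ * (2 * X / c)) ≤ Real.exp ε := Real.exp_le_exp.2 hδ3
        _ = Real.exp (2 * ε) * Real.exp (-ε) := by rw [← Real.exp_add]; ring_nf
        _ ≤ _ := by gcongr)
  have main := h.le_natEntropy_outputDensity_sub hC
    (fun e he => h.isChannel.abs_natEntropy_sub_log_le (hBf 1 one_pos) (hpk 1 one_pos) he)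
    hω0.le (min_le_left _ _) (min_le_right _ _) hL hM (by positivity) hε
    (fun e he => h.integral_tail_le (by linarith) (hpk ε hε) hX0 (by linarith) he)
  have t1 : (Real.log (Bf ε) + D) / X ^ 2 ≤ ε := by
    rw [div_le_iff₀ (by positivity)]
    have : ε * X = Real.log (Bf ε) + D + 5 := by rw [hX]; field_simp
    nlinarith
  have t2 : 5 / X ≤ ε := by
    rw [div_le_iff₀ hX0]
    have : ε * X = Real.log (Bf ε) + D + 5 := by rw [hX]; field_simp
    linarith
  have t3 : Real.log (Real.exp (2 * ε) * (1 + ε) + ε) ≤ 4 * ε := by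
    rw [Real.log_le_iff_le_exp (by positivity)]
    have e1 := Real.add_one_le_exp ε
    have e2 : Real.exp (2 * ε) = Real.exp ε ^ 2 := by rw [← Real.exp_nat_mul]; norm_num
    have e4 : Real.exp (4 * ε) = Real.exp ε ^ 4 := by rw [← Real.exp_nat_mul]; norm_num
    rw [e2, e4]
    set y := Real.exp ε
    have y1 : 1 ≤ y := by linarith
    calc y ^ 2 * (1 + ε) + ε ≤ y ^ 2 * y + (y - 1) := by gcongr <;> linarith
      _ ≤ y ^ 4 := by
        have : y - 1 ≤ y ^ 3 * (y - 1) :=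
          le_mul_of_one_le_left (by linarith) (one_le_pow₀ y1)
        nlinarith
  linarith

/-! ### The capacity -/

theorem mutualInfo_eq (f : ℝ → ℝ → ℝ) (p : ℝ → ℝ) :
    mutualInfo f p = (natEntropy (outputDensity f p) - ∫ e, natEntropy (f e) * p e) /
      Real.log 2 := by
  simp only [mutualInfo, entropy_eq_natEntropy_div, div_mul_eq_mul_div, integral_div, sub_div]

theorem SlowChannel.isLUB_capacity {a b qm qM c δ C : ℝ} {f : ℝ → ℝ → ℝ}
    (h : SlowChannel a b qm qM c δ f) (hC : ∀ e ∈ Ioo a b, |natEntropy (f e)| ≤ C) :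
    IsLUB (mutualInfoValues a b f) (capacity a b f) := by
  refine isLUB_csSup ⟨_, _, h.isInputDensity_nearOptimalInput hC, rfl⟩
    ⟨(volume.real (Ioo qm qM) + C) / Real.log 2, ?_⟩
  rintro _ ⟨p, hp, rfl⟩
  rw [mutualInfo_eq]
  have h1 := natEntropy_outputDensity_le_length h.isChannel hp hC
  have hpI : HasIntegralValue p 1 := ⟨hp.integrable, hp.integral_eq_one⟩
  have h2 := (hpI.const_mul (-C)).mono
    (integrable_natEntropy_mul h.isChannel hp hC).hasIntegralValue fun e => by
      by_cases he : e ∈ Ioo a b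
      · exact mul_le_mul_of_nonneg_right (abs_le.1 (hC e he)).1 (hp.nonneg e)
      · simp [hp.eq_zero e he]
  have h3 := Real.log_pos one_lt_two
  gcongr
  linarith

/-- The peak condition in nats, with the height raised to at least `3`, where the logarithm exceeds
`1`. -/
theorem SlowChangeRegime.exists_peakBound {ι : Type*} {l : Filter ι} {a b qm qM : ℝ}
    {f : ι → ℝ → ℝ → ℝ} (hf : SlowChangeRegime l a b qm qM f) (η : ℝ) :
    ∃ B : ℝ, 3 ≤ B ∧ (0 < η → ∀ i, PeakBound a b B η (f i)) := by
  by_cases hη : 0 < η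
  swap
  · exact ⟨3, le_rfl, fun h => absurd h hη⟩
  have hlog := Real.log_pos one_lt_two
  obtain ⟨B, hB, H⟩ := hf.peaks (η / Real.log 2) (by positivity)
  refine ⟨max B 3, le_max_right _ _, fun _ i e he => ?_⟩
  have hch := hf.isChannel i
  have h1 := H i e he
  simp only [Real.logb, ← mul_div_assoc] at h1
  rw [integral_div, div_le_div_iff_of_pos_right hlog] at h1
  refine le_trans (setIntegral_mono_set (hch.integrable_shape_mul_log he).integrableOn ?_
    (Eventually.of_forall fun x hx => ?_)) h1
  · filter_upwards [ae_restrict_mem (hch.measurableSet_peak B e)] with x hx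
    have hx1 : 1 ≤ shape (f i) e x := hB.trans (le_of_lt hx)
    exact mul_nonneg (by linarith) (Real.log_nonneg hx1)
  · exact (le_max_left B 3).trans_lt hx

end SlowChange

open SlowChange in
theorem corollary2 {ι : Type*} (l : Filter ι) (eMin eMax qMin qMax : ℝ) (he : eMin < eMax)
    (f : ι → ℝ → ℝ → ℝ) (hf : SlowChange.SlowChangeRegime l eMin eMax qMin qMax f) :
    (∀ i, IsLUB (SlowChange.mutualInfoValues eMin eMax (f i))
        (SlowChange.capacity eMin eMax (f i))) ∧
      (∀ i, 0 < SlowChange.normConst eMin eMax (f i)) ∧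
      Tendsto (fun i => SlowChange.capacity eMin eMax (f i) -
        Real.logb 2 (SlowChange.normConst eMin eMax (f i))) l (𝓝 0) := by
  obtain ⟨c, hc, hslope⟩ := hf.slope
  obtain ⟨δ, hδ, hslow⟩ := hf.slow
  choose Bf hBf3 hBfp using hf.exists_peakBound
  have hch : ∀ i, SlowChannel eMin eMax qMin qMax c (δ i) (f i) := fun i =>
    ⟨he, hf.isChannel i, hslow i, hc, hslope i⟩
  have hpk : ∀ i η, 0 < η → PeakBound eMin eMax (Bf η) η (f i) := fun i η hη => hBfp η hη i
  have hC : ∀ i, ∃ C, ∀ e ∈ Ioo eMin eMax, |natEntropy (f i e)| ≤ C := fun i =>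
    (hch i).exists_abs_natEntropy_le (hBf3 1) (hpk i 1 one_pos)
  have hlub : ∀ i, IsLUB (mutualInfoValues eMin eMax (f i)) (capacity eMin eMax (f i)) :=
    fun i => (hC i).elim fun _ hC => (hch i).isLUB_capacity hC
  refine ⟨hlub, fun i => (hC i).elim fun _ hC => (hch i).normConst_pos hC, ?_⟩
  have hlog := Real.log_pos one_lt_two
  rw [Metric.tendsto_nhds]
  intro r hr
  set ε := min 1 (r * Real.log 2 / 8) with hε
  have hε0 : 0 < ε := by positivity
  obtain ⟨δ₁, hδ₁, s₀, hs₀, hup⟩ := exists_upper_bound he hc Bf (fun η _ => hBf3 η) hε0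
  obtain ⟨δ₂, hδ₂, hlow⟩ := exists_lower_bound (a := eMin) (b := eMax) hc Bf (fun η _ => hBf3 η)
    hε0 (min_le_left _ _)
  filter_upwards [hδ.eventually_le_const hδ₁, hδ.eventually_le_const hδ₂,
    hf.sigmaMax_tendsto.eventually_le_const hs₀] with i h1 h2 h3
  obtain ⟨C, hCi⟩ := hC i
  have hN := (hch i).normConst_pos hCi
  have h7 : 7 * ε < r * Real.log 2 := by
    have := min_le_right 1 (r * Real.log 2 / 8)
    have : 0 < r * Real.log 2 := by positivity
    linarith
  have hle : capacity eMin eMax (f i) ≤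
      (Real.log (normConst eMin eMax (f i)) + 3 * ε) / Real.log 2 := by
    refine (isLUB_le_iff (hlub i)).2 ?_
    rintro _ ⟨p, hp, rfl⟩
    rw [mutualInfo_eq]
    have := hup qMin qMax (δ i) (f i) (hch i) h1 h3 (hpk i) p hp
    gcongr
  have hge : (Real.log (normConst eMin eMax (f i)) - 7 * ε) / Real.log 2 ≤
      capacity eMin eMax (f i) := by
    refine le_trans ?_ ((hlub i).1 ⟨_, (hch i).isInputDensity_nearOptimalInput hCi, rfl⟩)
    rw [mutualInfo_eq]
    have := hlow qMin qMax (δ i) (f i) (hch i) h2 (hpk i)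
    gcongr
  rw [le_div_iff₀ hlog] at hle
  rw [div_le_iff₀ hlog] at hge
  rw [Real.dist_eq, sub_zero, Real.logb, abs_lt]
  constructor
  · have : (Real.log (normConst eMin eMax (f i)) - r * Real.log 2) / Real.log 2 <
        capacity eMin eMax (f i) := by rw [div_lt_iff₀ hlog]; linarith
    rw [sub_div, mul_div_cancel_right₀ _ hlog.ne'] at this
    linarith
  · have : capacity eMin eMax (f i) <
        (Real.log (normConst eMin eMax (f i)) + r * Real.log 2) / Real.log 2 := by
      rw [lt_div_iff₀ hlog]; linarith
    rw [add_div, mul_div_cancel_right₀ _ hlog.ne'] at this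
    linarith
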